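/- **Conventions.** All functions and Hilbert spaces are real. A *reproducing kernel Hilbert space* (RKHS) on a set $X$ is a Hilbert space $H$ of functions $X\to\mathbb R$ on which all point evaluations are continuous; its *reproducing kernel* is the function $\Phi\colon X\times X\to\mathbb R$ such that $\Phi(x,\cdot)\in H$ represents the evaluation at $x$. A function $\Phi$ is called a *reproducing kernel* if it is the reproducing kernel of some RKHS on $X$; this RKHS is then unique, is called the *native space* of $\Phi$, and is denoted $\mathcal N_\Phi(X)$. The *Hilbert tensor product* $\bigotimes_{j=1}^n H_j$ is the completion of the algebraic tensor product under the inner product determined by $\langle\bigotimes_j f_j,\bigotimes_j g_j\rangle=\prod_j\langle f_j,g_j\rangle_{H_j}$; if the $H_j$ are spaces of functions on sets $X_j$, then $\bigotimes_j f_j$ is identified with the function $(x_1,\dots,x_n)\mapsto\prod_j f_j(x_j)$. Let $D=\{D_j\}_{j=1}^n$ be a partition of $\{1,\dots,d\}$, $d_j:=|D_j|$, and let $x_{D_j}\in\mathbb R^{d_j}$ denote the components of $x\in\mathbb R^d$ with index in $D_j$. The Fourier transform is $\hat f(\omega)=\int f(x)e^{-2\pi i x\cdot\omega}\,dx$, extended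 to $L^2$. For $\bm\beta=(\beta_1,\dots,\beta_n)$ let $$H^{\bm\beta}_D(\mathbb R^d):=\Big\{f\in L^2(\mathbb R^d):\ \|f\|_{H^{\bm\beta}_D(\mathbb R^d)}:=\Big\|\prod_{j=1}^n(1+|\omega_{D_j}|^2)^{\beta_j/2}\hat f\Big\|_{L^2(\mathbb R^d)}<\infty\Big\}.$$ If $\beta_j>d_j/2$ for all $j$, the elements of this space are identified with their continuous representatives, and for an arbitrary subset $\Gamma\subset\mathbb R^d$ let $H^{\bm\beta}_D(\Gamma)$ be the space of the restrictions $g|_\Gamma$, $g\in H^{\bm\beta}_D(\mathbb R^d)$, with the norm $\|f\|_{H^{\bm\beta}_D(\Gamma)}:=\inf_{g|_\Gamma=f}\|g\|_{H^{\bm\beta}_D(\mathbb R^d)}$. For a partition with only one block we write $H^\beta(\Gamma)$. **Proposition.** (i) Let $D=\{D_j\}_{j=1}^n$ be a partition of $\{1,\dots,d\}$ and let $\beta_j>d_j/2$ for each $j$. For each $j$ let $\phi_j\colon\mathbb R^{d_j}\to\mathbb R$ be continuous and square integrable, with a real-valued Fourier transform that satisfies, for some constants $c_j,C_j>0$ and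 almost all $\omega\in\mathbb R^{d_j}$, $$c_j(1+|\omega|^2)^{-\beta_j}\le\hat\phi_j(\omega)\le C_j(1+|\omega|^2)^{-\beta_j}.$$ Then $\Phi(x,y):=\prod_{j=1}^n\phi_j(x_{D_j}-y_{D_j})$ is a reproducing kernel on $\mathbb R^d$, the functions in its native space are continuous, and $\mathcal N_\Phi(\mathbb R^d)= H^{\bm\beta}_D(\mathbb R^d)$ with equivalent norms. (ii) If $\Phi\colon X\times X\to\mathbb R$ is a reproducing kernel on a set $X$ and $\Gamma\subset X$, then $\Phi|_{\Gamma\times\Gamma}$ is a reproducing kernel, and its native space is $$\mathcal N_{\Phi|_{\Gamma\times\Gamma}}(\Gamma)=\{g|_\Gamma:\ g\in\mathcal N_\Phi(X)\},\qquad \|f\|_{\mathcal N_{\Phi|_{\Gamma\times\Gamma}}(\Gamma)}=\inf_{g|_\Gamma=f}\|g\|_{\mathcal N_\Phi(X)}.$$ (iii) If $\Phi_j\colon X_j\times X_j\to\mathbb R$ are reproducing kernels, $j\in\{1,\dots,n\}$, then $\Phi(x,y):=\prod_{j=1}^n\Phi_j(x_j,y_j)$ is a reproducing kernel on $\prod_{j=1}^nX_j$,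 and $$\mathcal N_\Phi\Big(\prod_{j=1}^nX_j\Big)=\bigotimes_{j=1}^n\mathcal N_{\Phi_j}(X_j)$$ isometrically, under the identification above. (iv) Let $D=\{D_j\}_{j=1}^n$ be a partition of $\{1,\dots,d\}$ and let $\beta_j>d_j/2$ for each $j$. Then for any sets $\Gamma_j\subset\mathbb R^{d_j}$, $j\in\{1,\dots,n\}$, the spaces $H^{\beta_j}(\Gamma_j)$ are Hilbert spaces, and with $\prod_{j}\Gamma_j:=\{x\in\mathbb R^d: x_{D_j}\in\Gamma_j\text{ for all }j\}$ we have $$H^{\bm\beta}_D\Big(\prod_{j=1}^n\Gamma_j\Big)=\bigotimes_{j=1}^nH^{\beta_j}(\Gamma_j)$$ isometrically, under the identification above. -/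

import Mathlib

open MeasureTheory FourierTransform
open scoped TensorProduct

/-! ### Reproducing kernels and native spaces -/

/-- `Φ` is the reproducing kernel of the Hilbert space of functions `H`: `Φ (x, ·)` is the function
that represents the evaluation at `x`. -/
def HasReproducingKernel {X : Type*} (H : Type*) [NormedAddCommGroup H] [InnerProductSpace ℝ H]
    [CompleteSpace H] [RKHS ℝ H X ℝ] (Φ : X → X → ℝ) : Prop :=
  ∀ x y, RKHS.kerFun H x 1 y = Φ x y

/-- `Φ` is the reproducing kernel of some reproducing kernel Hilbert space of functions on `X`. -/
def IsReproducingKernel.{u} {X : Type u} (Φ : X → X → ℝ) : Prop :=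
  ∃ (H : Type u) (_ : NormedAddCommGroup H) (_ : InnerProductSpace ℝ H) (_ : CompleteSpace H)
    (_ : RKHS ℝ H X ℝ), HasReproducingKernel H Φ

/-- The native space of a reproducing kernel `Φ`: the reproducing kernel Hilbert space with kernel
`Φ` (as a Hilbert space of functions on `X` it is uniquely determined by `Φ`). -/
noncomputable def NativeSpace.{u} {X : Type u} (Φ : X → X → ℝ) (hΦ : IsReproducingKernel Φ) :
    Type u :=
  hΦ.choose

namespace NativeSpace

variable {X : Type*} (Φ : X → X → ℝ) (hΦ : IsReproducingKernel Φ)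

noncomputable instance : NormedAddCommGroup (NativeSpace Φ hΦ) :=
  hΦ.choose_spec.choose

noncomputable instance : InnerProductSpace ℝ (NativeSpace Φ hΦ) :=
  hΦ.choose_spec.choose_spec.choose

instance : CompleteSpace (NativeSpace Φ hΦ) :=
  hΦ.choose_spec.choose_spec.choose_spec.choose

noncomputable instance : RKHS ℝ (NativeSpace Φ hΦ) X ℝ :=
  hΦ.choose_spec.choose_spec.choose_spec.choose_spec.choose

theorem hasReproducingKernel : HasReproducingKernel (NativeSpace Φ hΦ) Φ :=
  hΦ.choose_spec.choose_spec.choose_spec.choose_spec.choose_spec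

end NativeSpace

/-! ### The Hilbert tensor product -/

/-- The algebraic tensor product of the spaces `H j`, a type of its own because the tensor
product in the library already carries another norm. -/
def AlgTensor {κ : Type*} (H : κ → Type*) [∀ j, SeminormedAddCommGroup (H j)]
    [∀ j, InnerProductSpace ℝ (H j)] : Type _ :=
  ⨂[ℝ] j, H j

namespace AlgTensor

variable {κ : Type*} [Fintype κ] (H : κ → Type*) [∀ j, SeminormedAddCommGroup (H j)]
  [∀ j, InnerProductSpace ℝ (H j)]

noncomputable instance : AddCommGroup (AlgTensor H) :=
  inferInstanceAs (AddCommGroup (⨂[ℝ] j, H j))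

noncomputable instance : Module ℝ (AlgTensor H) :=
  inferInstanceAs (Module ℝ (⨂[ℝ] j, H j))

/-- The bilinear form on the algebraic tensor product with
`⟨⨂ f j, ⨂ g j⟩ = ∏ j, ⟨f j, g j⟩`. -/
noncomputable def form : AlgTensor H →ₗ[ℝ] AlgTensor H →ₗ[ℝ] ℝ :=
  (PiTensorProduct.dualDistrib (R := ℝ) (M := H)).comp
    (PiTensorProduct.map (fun j => innerₗ (H j)))

variable {H} in
/-- The elementary tensor `⨂ j, f j`. -/
noncomputable def tprod (f : ∀ j, H j) : AlgTensor H := PiTensorProduct.tprod ℝ f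

theorem form_tprod (f g : ∀ j, H j) :
    form H (tprod f) (tprod g) = ∏ j, inner ℝ (f j) (g j) := by
  change PiTensorProduct.dualDistrib (PiTensorProduct.map (fun j => innerₗ (H j))
    (PiTensorProduct.tprod ℝ f)) (PiTensorProduct.tprod ℝ g) = _
  rw [PiTensorProduct.map_tprod, PiTensorProduct.dualDistrib_apply]
  rfl

set_option linter.unusedSectionVars false in
theorem span_tprod : Submodule.span ℝ (Set.range (tprod (H := H))) = ⊤ :=
  PiTensorProduct.span_tprod_eq_top

theorem form_symm (x y : AlgTensor H) : form H x y = form H y x := by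
  have hx : x ∈ Submodule.span ℝ (Set.range (tprod (H := H))) := by simp [span_tprod]
  have hy : y ∈ Submodule.span ℝ (Set.range (tprod (H := H))) := by simp [span_tprod]
  induction hx, hy using Submodule.span_induction₂ with
  | mem_mem x y hx hy =>
    obtain ⟨f, rfl⟩ := hx
    obtain ⟨g, rfl⟩ := hy
    rw [form_tprod, form_tprod]
    exact Finset.prod_congr rfl fun j _ => real_inner_comm _ _
  | zero_left y hy => simp
  | zero_right x hx => simp
  | add_left x y z _ _ _ h1 h2 => simp [h1, h2]
  | add_right x y z _ _ _ h1 h2 => simp [h1, h2]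
  | smul_left r x y _ _ h => simp [h]
  | smul_right r x y _ _ h => simp [h]

theorem form_nonneg (x : AlgTensor H) : 0 ≤ form H x x := by
  have hx : x ∈ Submodule.span ℝ (Set.range (tprod (H := H))) := by simp [span_tprod]
  obtain ⟨c, rfl⟩ := Finsupp.mem_span_range_iff_exists_finsupp.1 hx
  have key : ∀ s : Finset κ, (Matrix.of fun f g : c.support =>
      ∏ j ∈ s, inner ℝ (f.1 j) (g.1 j)).PosSemidef := by
    classical
    intro s
    induction s using Finset.induction_on with
    | empty =>
      have e : (Matrix.of fun f g : c.support => ∏ j ∈ (∅ : Finset κ), inner ℝ (f.1 j) (g.1 j)) =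
          Matrix.gram ℝ (fun _ : c.support => (1 : ℝ)) := by
        ext f g
        simp [Matrix.gram]
      rw [e]
      exact Matrix.posSemidef_gram ℝ _
    | insert a s ha ih =>
      have e : (Matrix.of fun f g : c.support => ∏ j ∈ insert a s, inner ℝ (f.1 j) (g.1 j)) =
          (Matrix.gram ℝ (fun f : c.support => f.1 a)).hadamard
            (Matrix.of fun f g : c.support => ∏ j ∈ s, inner ℝ (f.1 j) (g.1 j)) := by
        ext f g
        simp [Matrix.gram, Finset.prod_insert ha]
      rw [e]
      exact (Matrix.posSemidef_gram ℝ _).hadamard ih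
  have h := (key Finset.univ).dotProduct_mulVec_nonneg (fun f => c f.1)
  have e : form H (c.sum fun i a => a • tprod i) (c.sum fun i a => a • tprod i) =
      ∑ f : c.support, ∑ g : c.support, c f.1 * (c g.1 * ∏ j, inner ℝ (f.1 j) (g.1 j)) := by
    simp only [Finsupp.sum, map_sum, LinearMap.sum_apply, map_smul, LinearMap.smul_apply,
      form_tprod, smul_eq_mul]
    rw [← Finset.sum_coe_sort]
    refine Finset.sum_congr rfl fun f _ => ?_
    rw [Finset.sum_coe_sort c.support fun g => c f.1 * (c g * ∏ j, inner ℝ (f.1 j) (g j)),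
      Finset.mul_sum]
    refine Finset.sum_congr rfl fun g _ => ?_
    simp only [real_inner_comm]
  rw [e]
  refine h.trans_eq ?_
  simp only [dotProduct, Matrix.mulVec, Matrix.of_apply, Pi.star_apply, star_trivial,
    Finset.mul_sum]
  refine Finset.sum_congr rfl fun f _ => Finset.sum_congr rfl fun g _ => ?_
  rw [mul_comm (c g.1)]

noncomputable instance core : PreInnerProductSpace.Core ℝ (AlgTensor H) where
  inner x y := form H x y
  conj_inner_symm x y := form_symm H y x
  re_inner_nonneg x := form_nonneg H x
  add_left x y z := by simp
  smul_left x y r := by simp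

noncomputable instance : SeminormedAddCommGroup (AlgTensor H) :=
  InnerProductSpace.Core.toSeminormedAddCommGroup (𝕜 := ℝ)

noncomputable instance : InnerProductSpace ℝ (AlgTensor H) := .ofCore (core H)

theorem inner_tprod (f g : ∀ j, H j) :
    inner ℝ (tprod f) (tprod g) = ∏ j, inner ℝ (f j) (g j) := form_tprod H f g

end AlgTensor

/-- The Hilbert tensor product: the completion of the algebraic tensor product with respect to
the inner product `⟨⨂ f j, ⨂ g j⟩ = ∏ j, ⟨f j, g j⟩`. -/
abbrev HilbertTensor {κ : Type*} [Fintype κ] (H : κ → Type*) [∀ j, SeminormedAddCommGroup (H j)]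
    [∀ j, InnerProductSpace ℝ (H j)] : Type _ :=
  UniformSpace.Completion (AlgTensor H)

/-- The elementary tensor `⨂ j, f j` in the Hilbert tensor product. -/
noncomputable def HilbertTensor.tprod {κ : Type*} [Fintype κ] {H : κ → Type*}
    [∀ j, SeminormedAddCommGroup (H j)] [∀ j, InnerProductSpace ℝ (H j)] (f : ∀ j, H j) :
    HilbertTensor H :=
  ((AlgTensor.tprod f : AlgTensor H) : UniformSpace.Completion (AlgTensor H))

/-! ### Sobolev spaces on the whole space -/

/-- The group `x_B ∈ ℝ^B` of the components of `x ∈ ℝ^ι` with index in `B`. -/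
noncomputable def block {ι : Type*} (B : Finset ι) (x : EuclideanSpace ℝ ι) :
    EuclideanSpace ℝ B :=
  WithLp.toLp 2 fun i => x i

/-- The `L²` Fourier transform of a real-valued function; for integrable functions it is
`ω ↦ ∫ exp (-2πi ⟨x, ω⟩) f x dx`. -/
noncomputable def l2Fourier {ι : Type*} [Fintype ι] :
    Lp ℝ 2 (volume : Measure (EuclideanSpace ℝ ι)) →ₗ[ℝ]
      Lp ℂ 2 (volume : Measure (EuclideanSpace ℝ ι)) :=
  ((Lp.fourierTransformₗᵢ (EuclideanSpace ℝ ι) ℂ).toLinearEquiv.toLinearMap.restrictScalars ℝ).comp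
    (Complex.ofRealCLM.compLpₗ 2 volume)

/-- The weight `ω ↦ ∏ j, (1 + |ω_{D j}|²) ^ (β j / 2)`. -/
noncomputable def sobolevWeight {ι κ : Type*} [Fintype κ] (D : κ → Finset ι) (β : κ → ℝ)
    (ω : EuclideanSpace ℝ ι) : ℝ :=
  ∏ j, (1 + ‖block (D j) ω‖ ^ 2) ^ (β j / 2)

section Sobolev

variable {ι κ : Type*} [Fintype ι] [Fintype κ] (D : κ → Finset ι) (β : κ → ℝ)

set_option linter.unusedSectionVars false in
theorem sobolevWeight_pos (ω : EuclideanSpace ℝ ι) : 0 < sobolevWeight D β ω :=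
  Finset.prod_pos fun j _ => by positivity

/-- The real-valued `f ∈ L²(ℝ^ι)` whose Fourier transform, multiplied by the weight, is in `L²`. -/
noncomputable def sobolevSubmodule :
    Submodule ℝ (Lp ℝ 2 (volume : Measure (EuclideanSpace ℝ ι))) where
  carrier := {f | MemLp (fun ω => sobolevWeight D β ω • l2Fourier f ω) 2 volume}
  zero_mem' := by
    simp only [Set.mem_ofPred_eq, map_zero]
    refine (MemLp.zero (ε := ℂ)).ae_eq ?_
    filter_upwards [Lp.coeFn_zero ℂ 2 (volume : Measure (EuclideanSpace ℝ ι))] with ω h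
    rw [h]
    simp
  add_mem' {f g} hf hg := by
    simp only [Set.mem_ofPred_eq, map_add] at *
    refine (hf.add hg).ae_eq ?_
    filter_upwards [Lp.coeFn_add (l2Fourier f) (l2Fourier g)] with ω h
    simp only [Pi.add_apply, h, smul_add]
  smul_mem' c f hf := by
    simp only [Set.mem_ofPred_eq, map_smul] at *
    refine (hf.const_smul c).ae_eq ?_
    filter_upwards [Lp.coeFn_smul c (l2Fourier f)] with ω h
    simp only [Pi.smul_apply, h]
    exact smul_comm _ _ _

/-- The Sobolev space `H^β_D(ℝ^ι)`, where `D` is a partition of the index set `ι`. -/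
def Sobolev : Type _ := sobolevSubmodule D β

namespace Sobolev

noncomputable instance : AddCommGroup (Sobolev D β) :=
  inferInstanceAs (AddCommGroup (sobolevSubmodule D β))

noncomputable instance : Module ℝ (Sobolev D β) :=
  inferInstanceAs (Module ℝ (sobolevSubmodule D β))

/-- The `L²` function underlying an element of the Sobolev space. -/
noncomputable def toL2 :
    Sobolev D β →ₗ[ℝ] Lp ℝ 2 (volume : Measure (EuclideanSpace ℝ ι)) :=
  (sobolevSubmodule D β).subtype

theorem memLp_weighted (f : Sobolev D β) :
    MemLp (fun ω => sobolevWeight D β ω • l2Fourier (toL2 D β f) ω) 2 volume := f.2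

/-- `f ↦ ∏ j, (1 + |ω_{D j}|²) ^ (β j / 2) * f̂`, an element of `L²`. -/
noncomputable def weighted :
    Sobolev D β →ₗ[ℝ] Lp ℂ 2 (volume : Measure (EuclideanSpace ℝ ι)) where
  toFun f := MemLp.toLp _ (memLp_weighted D β f)
  map_add' f g := by
    rw [← MemLp.toLp_add]
    refine MemLp.toLp_congr _ _ ?_
    filter_upwards [Lp.coeFn_add (l2Fourier (toL2 D β f)) (l2Fourier (toL2 D β g))] with ω h
    simp only [map_add, Pi.add_apply, h, smul_add]
  map_smul' c f := by
    rw [RingHom.id_apply, ← MemLp.toLp_const_smul]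
    refine MemLp.toLp_congr _ _ ?_
    filter_upwards [Lp.coeFn_smul c (l2Fourier (toL2 D β f))] with ω h
    simp only [map_smul, Pi.smul_apply, h]
    exact smul_comm _ _ _

theorem weighted_injective : Function.Injective (weighted D β) := by
  refine (injective_iff_map_eq_zero _).2 fun f hf => ?_
  have h1 : l2Fourier (toL2 D β f) = 0 := by
    refine Lp.ext ?_
    have h2 : (fun ω => sobolevWeight D β ω • l2Fourier (toL2 D β f) ω) =ᵐ[volume]
        (weighted D β f : EuclideanSpace ℝ ι → ℂ) := (MemLp.coeFn_toLp (memLp_weighted D β f)).symm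
    rw [hf] at h2
    filter_upwards [h2, Lp.coeFn_zero ℂ 2 (volume : Measure (EuclideanSpace ℝ ι))] with ω h3 h4
    rw [h4] at h3 ⊢
    simpa [(sobolevWeight_pos D β ω).ne'] using h3
  have h2 : Complex.ofRealCLM.compLp (toL2 D β f) = 0 :=
    (Lp.fourierTransformₗᵢ (EuclideanSpace ℝ ι) ℂ).injective (by rw [map_zero]; exact h1)
  have h3 : toL2 D β f = 0 := by
    refine Lp.ext ?_
    have h4 := Complex.ofRealCLM.coeFn_compLp (toL2 D β f)
    rw [h2] at h4
    filter_upwards [h4, Lp.coeFn_zero ℂ 2 (volume : Measure (EuclideanSpace ℝ ι)),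
      Lp.coeFn_zero ℝ 2 (volume : Measure (EuclideanSpace ℝ ι))] with x h5 h6 h7
    rw [h6] at h5
    rw [h7]
    simpa using h5.symm
  exact Subtype.ext h3

/-- `‖f‖ = ‖∏ j, (1 + |ω_{D j}|²) ^ (β j / 2) * f̂‖_{L²}`. -/
noncomputable instance : NormedAddCommGroup (Sobolev D β) :=
  NormedAddCommGroup.induced (Sobolev D β) _ (weighted D β) (weighted_injective D β)

theorem norm_def (f : Sobolev D β) : ‖f‖ = ‖weighted D β f‖ := rfl

noncomputable instance : InnerProductSpace ℝ (Sobolev D β) where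
  norm_smul_le c f := by simp [norm_def, norm_smul]
  inner f g := (inner ℂ (weighted D β f) (weighted D β g)).re
  norm_sq_eq_re_inner f := by
    rw [norm_def]
    exact norm_sq_eq_re_inner (𝕜 := ℂ) _
  conj_inner_symm f g := by
    have := inner_re_symm (𝕜 := ℂ) (weighted D β g) (weighted D β f)
    exact this
  add_left f g h := by simp [inner_add_left]
  smul_left f g c := by
    have h : weighted D β (c • f) = (c : ℂ) • weighted D β f := by
      rw [map_smul]
      exact RCLike.real_smul_eq_coe_smul (K := ℂ) c _
    rw [h, inner_smul_left]
    simp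

end Sobolev

/-! ### Sobolev spaces on subsets -/

/-- `f` is the restriction to `Γ` of the function `u`, where `u` is understood as its continuous
representative (it exists when `β j > |D j| / 2` for all `j`), so that restriction makes sense for
every set `Γ`. -/
def IsRestriction (Γ : Set (EuclideanSpace ℝ ι)) (u : Sobolev D β) (f : Γ → ℝ) : Prop :=
  ∃ g : EuclideanSpace ℝ ι → ℝ, Continuous g ∧
    g =ᵐ[volume] (Sobolev.toL2 D β u : EuclideanSpace ℝ ι → ℝ) ∧ ∀ x : Γ, f x = g x

variable {D β} {Γ : Set (EuclideanSpace ℝ ι)}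

theorem IsRestriction.add {u v : Sobolev D β} {f g : Γ → ℝ} (hf : IsRestriction D β Γ u f)
    (hg : IsRestriction D β Γ v g) : IsRestriction D β Γ (u + v) (f + g) := by
  obtain ⟨F, hF, hFu, hFf⟩ := hf
  obtain ⟨G, hG, hGu, hGf⟩ := hg
  refine ⟨F + G, hF.add hG, ?_, fun x => by simp [hFf, hGf]⟩
  rw [map_add]
  filter_upwards [hFu, hGu, Lp.coeFn_add (Sobolev.toL2 D β u) (Sobolev.toL2 D β v)]
    with x h1 h2 h3
  simp only [Pi.add_apply, h1, h2, h3]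

theorem IsRestriction.smul {u : Sobolev D β} {f : Γ → ℝ} (c : ℝ)
    (hf : IsRestriction D β Γ u f) : IsRestriction D β Γ (c • u) (c • f) := by
  obtain ⟨F, hF, hFu, hFf⟩ := hf
  refine ⟨c • F, hF.const_smul c, ?_, fun x => by simp [hFf]⟩
  rw [map_smul]
  filter_upwards [hFu, Lp.coeFn_smul c (Sobolev.toL2 D β u)] with x h1 h3
  simp [h1, h3]

theorem IsRestriction.zero : IsRestriction D β Γ 0 0 := by
  refine ⟨0, continuous_zero, ?_, fun x => rfl⟩
  rw [map_zero]
  exact (Lp.coeFn_zero ℝ 2 _).symm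

variable (D β Γ)

/-- The restrictions to `Γ` of the functions in `H^β_D(ℝ^ι)`. -/
def restrictionSubmodule : Submodule ℝ (Γ → ℝ) where
  carrier := {f | ∃ u : Sobolev D β, IsRestriction D β Γ u f}
  zero_mem' := ⟨0, .zero⟩
  add_mem' := fun ⟨u, hu⟩ ⟨v, hv⟩ => ⟨u + v, hu.add hv⟩
  smul_mem' := fun c _ ⟨u, hu⟩ => ⟨c • u, hu.smul c⟩

/-- The Sobolev space `H^β_D(Γ)` on a set `Γ ⊆ ℝ^ι`, whose elements are the restrictions to `Γ`
of the functions in `H^β_D(ℝ^ι)`. -/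
def SobolevOn : Type _ := restrictionSubmodule D β Γ

namespace SobolevOn

noncomputable instance : AddCommGroup (SobolevOn D β Γ) :=
  inferInstanceAs (AddCommGroup (restrictionSubmodule D β Γ))

noncomputable instance : Module ℝ (SobolevOn D β Γ) :=
  inferInstanceAs (Module ℝ (restrictionSubmodule D β Γ))

variable {D β Γ}

/-- The function on `Γ` underlying an element of `H^β_D(Γ)`. -/
def toFun (f : SobolevOn D β Γ) : Γ → ℝ := f.1

instance : CoeFun (SobolevOn D β Γ) (fun _ => Γ → ℝ) := ⟨toFun⟩

/-- `‖f‖ = inf {‖u‖ : u ∈ H^β_D(ℝ^ι), u|_Γ = f}`. -/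
noncomputable instance : Norm (SobolevOn D β Γ) :=
  ⟨fun f => sInf {r | ∃ u : Sobolev D β, IsRestriction D β Γ u f ∧ r = ‖u‖}⟩

theorem norm_le {f : SobolevOn D β Γ} {u : Sobolev D β} (h : IsRestriction D β Γ u f) :
    ‖f‖ ≤ ‖u‖ :=
  csInf_le ⟨0, by rintro _ ⟨u, -, rfl⟩; exact norm_nonneg u⟩ ⟨u, h, rfl⟩

theorem exists_norm_lt (f : SobolevOn D β Γ) {ε : ℝ} (hε : 0 < ε) :
    ∃ u : Sobolev D β, IsRestriction D β Γ u f ∧ ‖u‖ < ‖f‖ + ε := by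
  obtain ⟨v, hv⟩ := f.2
  obtain ⟨_, ⟨u, hu, rfl⟩, h⟩ := exists_lt_of_csInf_lt
    (s := {r | ∃ u : Sobolev D β, IsRestriction D β Γ u f ∧ r = ‖u‖}) ⟨_, v, hv, rfl⟩
    (lt_add_of_pos_right _ hε)
  exact ⟨u, hu, h⟩

theorem norm_nonneg' (f : SobolevOn D β Γ) : 0 ≤ ‖f‖ :=
  Real.sInf_nonneg (by rintro _ ⟨u, -, rfl⟩; exact norm_nonneg u)

theorem norm_zero' : ‖(0 : SobolevOn D β Γ)‖ = 0 :=
  le_antisymm ((norm_le (f := 0) IsRestriction.zero).trans_eq norm_zero) (norm_nonneg' _)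

theorem norm_add_le' (f g : SobolevOn D β Γ) : ‖f + g‖ ≤ ‖f‖ + ‖g‖ := by
  refine le_of_forall_pos_le_add fun ε hε => ?_
  obtain ⟨u, hu, hu'⟩ := exists_norm_lt f (half_pos hε)
  obtain ⟨v, hv, hv'⟩ := exists_norm_lt g (half_pos hε)
  have := norm_le (f := f + g) (hu.add hv)
  linarith [norm_add_le u v]

theorem norm_smul_le_aux (c : ℝ) (f : SobolevOn D β Γ) : ‖c • f‖ ≤ ‖c‖ * ‖f‖ := by
  refine le_of_forall_pos_le_add fun ε hε => ?_
  have hc : 0 < ‖c‖ + 1 := by positivity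
  obtain ⟨u, hu, hu'⟩ := exists_norm_lt f (div_pos hε hc)
  have h1 : ‖c • f‖ ≤ ‖c • u‖ := norm_le (hu.smul c)
  rw [norm_smul c u] at h1
  have h2 : ‖c‖ * ‖u‖ ≤ ‖c‖ * (‖f‖ + ε / (‖c‖ + 1)) := by gcongr
  have h3 : ‖c‖ * (ε / (‖c‖ + 1)) ≤ ε := by
    rw [mul_div_assoc', div_le_iff₀ hc]
    nlinarith [norm_nonneg c]
  linarith

theorem norm_neg' (f : SobolevOn D β Γ) : ‖-f‖ = ‖f‖ := by
  have h (g : SobolevOn D β Γ) : ‖-g‖ ≤ ‖g‖ := by simpa using norm_smul_le_aux (-1) g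
  exact le_antisymm (h f) (by simpa using h (-f))

noncomputable instance : SeminormedAddCommGroup (SobolevOn D β Γ) :=
  AddGroupSeminorm.toSeminormedAddCommGroup
    { toFun := fun f => ‖f‖
      map_zero' := norm_zero'
      add_le' := norm_add_le'
      neg' := norm_neg' }

noncomputable instance : NormedSpace ℝ (SobolevOn D β Γ) := ⟨norm_smul_le_aux⟩

theorem parallelogram_le (f g : SobolevOn D β Γ) :
    ‖f + g‖ * ‖f + g‖ + ‖f - g‖ * ‖f - g‖ ≤ 2 * (‖f‖ * ‖f‖ + ‖g‖ * ‖g‖) := by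
  have h : ∀ ε : ℝ, 0 < ε → ‖f + g‖ * ‖f + g‖ + ‖f - g‖ * ‖f - g‖ ≤
      2 * ((‖f‖ + ε) * (‖f‖ + ε) + (‖g‖ + ε) * (‖g‖ + ε)) := by
    intro ε hε
    obtain ⟨u, hu, hu'⟩ := exists_norm_lt f hε
    obtain ⟨v, hv, hv'⟩ := exists_norm_lt g hε
    have h1 := norm_le (f := f + g) (hu.add hv)
    have h2 : ‖f - g‖ ≤ ‖u - v‖ := by
      refine norm_le ?_
      rw [sub_eq_add_neg, sub_eq_add_neg, ← neg_one_smul ℝ v, ← neg_one_smul ℝ g]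
      exact hu.add (hv.smul (-1))
    have h3 := parallelogram_law_with_norm_mul ℝ u v
    have h4 := mul_self_le_mul_self (norm_nonneg _) h1
    have h5 := mul_self_le_mul_self (norm_nonneg _) h2
    have h6 := mul_self_le_mul_self (norm_nonneg _) hu'.le
    have h7 := mul_self_le_mul_self (norm_nonneg _) hv'.le
    linarith
  have ht : Filter.Tendsto (fun ε : ℝ => 2 * ((‖f‖ + ε) * (‖f‖ + ε) + (‖g‖ + ε) * (‖g‖ + ε)))
      (nhdsWithin 0 (Set.Ioi 0)) (nhds (2 * (‖f‖ * ‖f‖ + ‖g‖ * ‖g‖))) := by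
    have : Continuous fun ε : ℝ => 2 * ((‖f‖ + ε) * (‖f‖ + ε) + (‖g‖ + ε) * (‖g‖ + ε)) := by
      fun_prop
    simpa using (this.tendsto 0).mono_left nhdsWithin_le_nhds
  exact ge_of_tendsto ht (by filter_upwards [self_mem_nhdsWithin] with ε hε using h ε hε)

theorem parallelogram (f g : SobolevOn D β Γ) :
    ‖f + g‖ * ‖f + g‖ + ‖f - g‖ * ‖f - g‖ = 2 * (‖f‖ * ‖f‖ + ‖g‖ * ‖g‖) := by
  refine le_antisymm (parallelogram_le f g) ?_
  have h := parallelogram_le (f + g) (f - g)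
  have h1 : f + g + (f - g) = (2 : ℝ) • f := by module
  have h2 : f + g - (f - g) = (2 : ℝ) • g := by module
  rw [h1, h2, norm_smul, norm_smul, Real.norm_ofNat] at h
  linarith

instance : InnerProductSpaceable (SeparationQuotient (SobolevOn D β Γ)) where
  parallelogram_identity := by
    refine SeparationQuotient.surjective_mk.forall₂.2 fun f g => ?_
    rw [← SeparationQuotient.mk_add, ← SeparationQuotient.mk_sub]
    simp only [SeparationQuotient.norm_mk]
    exact parallelogram f g

/-- The inner product of `H^β_D(Γ)` is the one that belongs to its norm. -/
noncomputable instance : InnerProductSpace ℝ (SobolevOn D β Γ) :=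
  letI : InnerProductSpace ℝ (SeparationQuotient (SobolevOn D β Γ)) :=
    InnerProductSpace.ofNorm ℝ InnerProductSpaceable.parallelogram_identity
  { inner f g := inner ℝ (SeparationQuotient.mk f) (SeparationQuotient.mk g)
    norm_sq_eq_re_inner f := by
      rw [← norm_sq_eq_re_inner (𝕜 := ℝ), SeparationQuotient.norm_mk]
    conj_inner_symm f g := inner_conj_symm (𝕜 := ℝ) _ _
    add_left f g h := by rw [SeparationQuotient.mk_add, inner_add_left]
    smul_left f g c := by rw [SeparationQuotient.mk_smul, inner_smul_left] }

end SobolevOn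

end Sobolev

/-- The isotropic Sobolev space `H^s(Γ)`, the case of a partition with one block. -/
abbrev IsotropicSobolevOn {ι : Type*} [Fintype ι] (s : ℝ) (Γ : Set (EuclideanSpace ℝ ι)) :
    Type _ :=
  SobolevOn (fun _ : Fin 1 => (Finset.univ : Finset ι)) (fun _ => s) Γ

/-- The blocks `D j` form a partition of the index set `ι`. -/
def IsBlockPartition {ι κ : Type*} (D : κ → Finset ι) : Prop :=
  (∀ j k, j ≠ k → Disjoint (D j) (D k)) ∧ ∀ i, ∃ j, i ∈ D j

/-- The product `∏ j, Γ j ⊆ ℝ^ι` of sets `Γ j ⊆ ℝ^(D j)`. -/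
def blockProd {ι κ : Type*} (D : κ → Finset ι) (Γ : ∀ j, Set (EuclideanSpace ℝ (D j))) :
    Set (EuclideanSpace ℝ ι) :=
  {x | ∀ j, block (D j) x ∈ Γ j}

/-! ### Hilbert spaces spanned by a family of vectors -/

section Gram

variable {X : Type*} {W₁ W₂ : Type*} [NormedAddCommGroup W₁] [InnerProductSpace ℝ W₁]
  [CompleteSpace W₁] [NormedAddCommGroup W₂] [InnerProductSpace ℝ W₂] [CompleteSpace W₂]

/-- Two Hilbert spaces with total families that have the same Gram matrix are isometric. -/
theorem exists_linearIsometryEquiv_of_inner_eq {k₁ : X → W₁} {k₂ : X → W₂}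
    (h : ∀ x y, inner ℝ (k₁ x) (k₁ y) = inner ℝ (k₂ x) (k₂ y))
    (h₁ : Dense (Submodule.span ℝ (Set.range k₁) : Set W₁))
    (h₂ : Dense (Submodule.span ℝ (Set.range k₂) : Set W₂)) :
    ∃ e : W₁ ≃ₗᵢ[ℝ] W₂, ∀ x, e (k₁ x) = k₂ x := by
  have d₁ : DenseRange (Finsupp.linearCombination ℝ k₁) := by
    rw [DenseRange, ← LinearMap.coe_range, Finsupp.range_linearCombination]
    exact h₁
  have d₂ : DenseRange (Finsupp.linearCombination ℝ k₂) := by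
    rw [DenseRange, ← LinearMap.coe_range, Finsupp.range_linearCombination]
    exact h₂
  have hn (c : X →₀ ℝ) : ‖Finsupp.linearCombination ℝ k₂ (LinearEquiv.refl ℝ (X →₀ ℝ) c)‖ =
      ‖Finsupp.linearCombination ℝ k₁ c‖ := by
    rw [← sq_eq_sq₀ (norm_nonneg _) (norm_nonneg _), ← real_inner_self_eq_norm_sq,
      ← real_inner_self_eq_norm_sq]
    simp [-inner_self_eq_norm_sq_to_K, Finsupp.linearCombination_apply, Finsupp.sum, sum_inner, inner_sum, inner_smul_left,
      inner_smul_right, h]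
  refine ⟨LinearEquiv.extendOfIsometry (LinearEquiv.refl ℝ (X →₀ ℝ)) _ _ d₁ d₂ hn, fun x => ?_⟩
  have := LinearEquiv.extendOfIsometry_eq (LinearEquiv.refl ℝ (X →₀ ℝ)) _ _ d₁ d₂ hn
    (Finsupp.single x 1)
  simpa using this

theorem dense_span_range_iff {k : X → W₁} :
    Dense (Submodule.span ℝ (Set.range k) : Set W₁) ↔ ∀ w, (∀ x, inner ℝ (k x) w = 0) → w = 0 := by
  rw [Submodule.dense_iff_topologicalClosure_eq_top, Submodule.topologicalClosure_eq_top_iff,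
    Submodule.eq_bot_iff]
  refine forall_congr' fun w => imp_congr_left ?_
  rw [Submodule.mem_orthogonal]
  refine ⟨fun hw x => hw _ (Submodule.subset_span ⟨x, rfl⟩), fun hw u hu => ?_⟩
  induction hu using Submodule.span_induction with
  | mem u hu => obtain ⟨x, rfl⟩ := hu; exact hw x
  | zero => simp
  | add u v _ _ hu hv => rw [inner_add_left, hu, hv, add_zero]
  | smul a u _ hu => rw [inner_smul_left, hu, mul_zero]

end Gram

/-! ### Feature maps and native spaces -/

section Feature

variable {X : Type*} {W : Type*} [NormedAddCommGroup W] [InnerProductSpace ℝ W]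

/-- The space of functions `x ↦ ⟪k x, w⟫` defined by a total family `k`. -/
noncomputable abbrev RKHS.ofFeature (k : X → W)
    (hk : ∀ w, (∀ x, inner ℝ (k x) w = 0) → w = 0) : RKHS ℝ W X ℝ where
  coeCLM := ContinuousLinearMap.pi fun x => innerSL ℝ (k x)
  coeCLM_injective := by
    intro v w h
    refine sub_eq_zero.1 (hk _ fun x => ?_)
    rw [inner_sub_right, sub_eq_zero]
    exact congrFun h x

variable [CompleteSpace W]

theorem RKHS.inner_kerFun_one {H : Type*} [NormedAddCommGroup H] [InnerProductSpace ℝ H]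
    [CompleteSpace H] [RKHS ℝ H X ℝ] (x : X) (f : H) : inner ℝ (RKHS.kerFun H x 1) f = f x := by
  rw [RKHS.kerFun_inner]
  simp

theorem isReproducingKernel_of_feature.{u} {X W : Type u} [NormedAddCommGroup W]
    [InnerProductSpace ℝ W] [CompleteSpace W] {Φ : X → X → ℝ} {k : X → W}
    (hk : ∀ w, (∀ x, inner ℝ (k x) w = 0) → w = 0) (h : ∀ x y, inner ℝ (k x) (k y) = Φ x y) :
    IsReproducingKernel Φ := by
  let _ := RKHS.ofFeature k hk
  have h1 (x : X) (w : W) : w x = inner ℝ (k x) w := rfl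
  refine ⟨W, inferInstance, inferInstance, inferInstance, RKHS.ofFeature k hk, fun x y => ?_⟩
  rw [h1, real_inner_comm, RKHS.inner_kerFun_one, h1, h]

namespace NativeSpace

variable (Φ : X → X → ℝ) (hΦ : IsReproducingKernel Φ)

/-- The kernel function `Φ (x, ·)`. -/
noncomputable def ker (x : X) : NativeSpace Φ hΦ := RKHS.kerFun (NativeSpace Φ hΦ) x 1

variable {Φ hΦ}

theorem inner_ker (x : X) (f : NativeSpace Φ hΦ) : inner ℝ (ker Φ hΦ x) f = f x :=
  RKHS.inner_kerFun_one x f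

theorem inner_ker_ker (x y : X) : inner ℝ (ker Φ hΦ x) (ker Φ hΦ y) = Φ x y := by
  rw [real_inner_comm, inner_ker]
  exact hasReproducingKernel Φ hΦ x y

theorem eq_zero_of_inner_ker (f : NativeSpace Φ hΦ) (hf : ∀ x, inner ℝ (ker Φ hΦ x) f = 0) :
    f = 0 :=
  RKHS.ext fun x => by rw [← inner_ker, hf, RKHS.coe_zero, Pi.zero_apply]

theorem dense_span_ker :
    Dense (Submodule.span ℝ (Set.range (ker Φ hΦ)) : Set (NativeSpace Φ hΦ)) :=
  dense_span_range_iff.2 eq_zero_of_inner_ker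

theorem exists_linearIsometryEquiv_of_feature {k : X → W}
    (hk : ∀ w, (∀ x, inner ℝ (k x) w = 0) → w = 0) (h : ∀ x y, inner ℝ (k x) (k y) = Φ x y) :
    ∃ e : W ≃ₗᵢ[ℝ] NativeSpace Φ hΦ, ∀ w x, e w x = inner ℝ (k x) w := by
  obtain ⟨e, he⟩ := exists_linearIsometryEquiv_of_inner_eq (k₁ := k) (k₂ := ker Φ hΦ)
    (fun x y => by rw [h, inner_ker_ker]) (dense_span_range_iff.2 hk) dense_span_ker
  refine ⟨e, fun w x => ?_⟩
  rw [← inner_ker, ← he, e.inner_map_map]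

end NativeSpace

end Feature

/-! ### Restriction of kernels -/

section Restriction

variable {X : Type*} {W : Type*} [NormedAddCommGroup W] [InnerProductSpace ℝ W] [CompleteSpace W]
  (k : X → W)

/-- The closed subspace spanned by a family of vectors. -/
noncomputable abbrev closedSpan : Submodule ℝ W :=
  (Submodule.span ℝ (Set.range k)).topologicalClosure

instance : CompleteSpace (closedSpan k) :=
  (Submodule.isClosed_topologicalClosure _).completeSpace_coe

/-- The vector `k x` as an element of the closed subspace spanned by the family. -/
noncomputable def closedSpan.mk (x : X) : closedSpan k :=
  ⟨k x, Submodule.le_topologicalClosure _ (Submodule.subset_span ⟨x, rfl⟩)⟩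

variable {k}

omit [CompleteSpace W] in
theorem closedSpan.eq_zero_of_inner (w : closedSpan k)
    (hw : ∀ x, inner ℝ (closedSpan.mk k x) w = 0) : w = 0 := by
  have h : (w : W) ∈ (closedSpan k)ᗮ := by
    rw [Submodule.orthogonal_closure, Submodule.mem_orthogonal]
    intro u hu
    induction hu using Submodule.span_induction with
    | mem u hu => obtain ⟨x, rfl⟩ := hu; exact hw x
    | zero => simp
    | add u v _ _ hu hv => rw [inner_add_left, hu, hv, add_zero]
    | smul a u _ hu => rw [inner_smul_left, hu, mul_zero]
  have := Submodule.inner_right_of_mem_orthogonal w.2 h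
  exact Subtype.ext (inner_self_eq_zero.1 this)

theorem closedSpan.dense_span_mk :
    Dense (Submodule.span ℝ (Set.range (closedSpan.mk k)) : Set (closedSpan k)) :=
  dense_span_range_iff.2 closedSpan.eq_zero_of_inner

/-- Among the vectors with given inner products with the family, there is one of smallest norm, and
it belongs to the closed span. -/
theorem closedSpan.exists_inner_eq (w : W) :
    ∃ v : closedSpan k, (∀ x, inner ℝ (k x) (v : W) = inner ℝ (k x) w) ∧ ‖v‖ ≤ ‖w‖ := by
  refine ⟨(closedSpan k).orthogonalProjectionOnto w, fun x => ?_,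
    (closedSpan k).norm_orthogonalProjectionOnto_apply_le w⟩
  exact Submodule.inner_orthogonalProjectionOnto_eq_of_mem_left (closedSpan.mk k x) w

theorem closedSpan.norm_le {v : closedSpan k} {w : W}
    (h : ∀ x, inner ℝ (k x) (v : W) = inner ℝ (k x) w) : ‖v‖ ≤ ‖w‖ := by
  obtain ⟨v', h', hn⟩ := closedSpan.exists_inner_eq (k := k) w
  have : v - v' = 0 := closedSpan.eq_zero_of_inner _ fun x => by
    change inner ℝ (k x) ((v : W) - v') = 0
    rw [inner_sub_right, h, h', sub_self]
  rwa [sub_eq_zero.1 this]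

end Restriction

theorem NativeSpace.exists_restrict {X : Type*} (Φ : X → X → ℝ) (hΦ : IsReproducingKernel Φ)
    (Γ : Set X) :
    ∃ hΓ : IsReproducingKernel fun x y : Γ => Φ x y,
      (∀ f : Γ → ℝ, (∃ h : NativeSpace _ hΓ, ∀ x, h x = f x) ↔
        ∃ g : NativeSpace Φ hΦ, ∀ x : Γ, g x = f x) ∧
      ∀ h : NativeSpace _ hΓ,
        IsGLB {r : ℝ | ∃ g : NativeSpace Φ hΦ, (∀ x : Γ, g x = h x) ∧ r = ‖g‖} ‖h‖ := by
  let k : Γ → NativeSpace Φ hΦ := fun x => ker Φ hΦ x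
  have hk (x y : Γ) : inner ℝ (closedSpan.mk k x) (closedSpan.mk k y) = Φ x y := inner_ker_ker _ _
  have hev (x : Γ) (g : NativeSpace Φ hΦ) : inner ℝ (k x) g = g x := inner_ker _ _
  have hΓ : IsReproducingKernel fun x y : Γ => Φ x y :=
    isReproducingKernel_of_feature (k := closedSpan.mk k) closedSpan.eq_zero_of_inner hk
  obtain ⟨e, he⟩ := exists_linearIsometryEquiv_of_feature (hΦ := hΓ) (k := closedSpan.mk k)
    closedSpan.eq_zero_of_inner hk
  have he' (v : closedSpan k) (x : Γ) : e v x = (v : NativeSpace Φ hΦ) x :=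
    (he v x).trans (hev x v)
  refine ⟨hΓ, fun f => ⟨fun ⟨h, hf⟩ => ?_, fun ⟨g, hf⟩ => ?_⟩, fun h => ⟨?_, ?_⟩⟩
  · refine ⟨(e.symm h : closedSpan k), fun x => ?_⟩
    rw [← he', e.apply_symm_apply, hf]
  · obtain ⟨v, hv, -⟩ := closedSpan.exists_inner_eq (k := k) g
    refine ⟨e v, fun x => ?_⟩
    rw [he', ← hev, hv, hev, hf]
  · rintro _ ⟨g, hg, rfl⟩
    rw [← e.symm.norm_map h]
    refine closedSpan.norm_le fun x => ?_
    rw [hev, ← he', e.apply_symm_apply, hev, hg]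
  · intro r hr
    refine hr ⟨(e.symm h : closedSpan k), fun x => ?_, ?_⟩
    · rw [← he', e.apply_symm_apply]
    · exact (e.symm.norm_map h).symm

/-! ### Total families in tensor products -/

namespace HilbertTensor

variable {κ : Type*} [Fintype κ] {H : κ → Type*} [∀ j, SeminormedAddCommGroup (H j)]
  [∀ j, InnerProductSpace ℝ (H j)]

theorem inner_tprod (f g : ∀ j, H j) :
    inner ℝ (tprod f) (tprod g) = ∏ j, inner ℝ (f j) (g j) := by
  rw [tprod, tprod, UniformSpace.Completion.inner_coe, AlgTensor.inner_tprod]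

theorem norm_tprod (f : ∀ j, H j) : ‖tprod f‖ = ∏ j, ‖f j‖ := by
  rw [← sq_eq_sq₀ (norm_nonneg _) (Finset.prod_nonneg fun _ _ => norm_nonneg _),
    ← real_inner_self_eq_norm_sq, inner_tprod, ← Finset.prod_pow]
  simp

/-- The multilinear map `f ↦ ⨂ j, f j`. -/
noncomputable def tprodₘ : MultilinearMap ℝ H (HilbertTensor H) :=
  (UniformSpace.Completion.toComplₗᵢ (𝕜 := ℝ) (E := AlgTensor H)).toLinearMap.compMultilinearMap
    (PiTensorProduct.tprod ℝ : MultilinearMap ℝ H (⨂[ℝ] j, H j))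

theorem tprodₘ_apply (f : ∀ j, H j) : tprodₘ f = tprod f := rfl

theorem dense_span_range_tprod :
    Dense (Submodule.span ℝ (Set.range (tprod : (∀ j, H j) → HilbertTensor H)) :
      Set (HilbertTensor H)) := by
  have h : Submodule.span ℝ (Set.range (tprod : (∀ j, H j) → HilbertTensor H)) =
      LinearMap.range
        (UniformSpace.Completion.toComplₗᵢ (𝕜 := ℝ) (E := AlgTensor H)).toLinearMap := by
    rw [LinearMap.range_eq_map, ← AlgTensor.span_tprod, Submodule.map_span, ← Set.range_comp]
    rfl
  rw [h]
  exact UniformSpace.Completion.denseRange_coe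

/-- Elementary tensors of vectors from total families form a total family. -/
theorem dense_span_tprod {X : κ → Type*} {k : ∀ j, X j → H j}
    (hk : ∀ j, Dense (Submodule.span ℝ (Set.range (k j)) : Set (H j))) :
    Dense (Submodule.span ℝ (Set.range fun x : ∀ j, X j => tprod fun j => k j (x j)) :
      Set (HilbertTensor H)) := by
  classical
  set S := (Submodule.span ℝ
    (Set.range fun x : ∀ j, X j => tprod fun j => k j (x j))).topologicalClosure with hS
  have hc : IsClosed (S : Set (HilbertTensor H)) := Submodule.isClosed_topologicalClosure _
  have key (s : Finset κ) : ∀ f : ∀ j, H j, (∀ j ∉ s, f j ∈ Set.range (k j)) → tprod f ∈ S := by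
    induction s using Finset.induction_on with
    | empty =>
      intro f hf
      choose x hx using fun j => hf j (Finset.notMem_empty j)
      refine Submodule.le_topologicalClosure _ (Submodule.subset_span ⟨x, ?_⟩)
      simp only [hx]
    | insert a s ha ih =>
      intro f hf
      let T : H a →L[ℝ] HilbertTensor H := (tprodₘ.toLinearMap f a).mkContinuous
        (∏ j ∈ Finset.univ.erase a, ‖f j‖) fun v => by
          rw [MultilinearMap.toLinearMap_apply, tprodₘ_apply, norm_tprod,
            ← Finset.prod_erase_mul _ _ (Finset.mem_univ a), Function.update_self]
          refine (congrArg (· * ‖v‖) (Finset.prod_congr rfl fun j hj => ?_)).le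
          rw [Function.update_of_ne (Finset.ne_of_mem_erase hj)]
      have hT (v : H a) : T v = tprod (Function.update f a v) := rfl
      have hle : Submodule.span ℝ (Set.range (k a)) ≤ S.comap T.toLinearMap := by
        rw [Submodule.span_le]
        rintro _ ⟨x, rfl⟩
        refine ih _ fun j hj => ?_
        by_cases hja : j = a
        · subst hja
          simp
        · rw [Function.update_of_ne hja]
          exact hf j (by simp [hj, hja])
      have hcl : IsClosed ((S.comap T.toLinearMap : Submodule ℝ (H a)) : Set (H a)) :=
        hc.preimage T.continuous
      have := hcl.closure_subset_iff.2 hle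
      rw [(hk a).closure_eq] at this
      have h2 : T (f a) ∈ S := this (Set.mem_univ (f a))
      rwa [hT, Function.update_eq_self] at h2
  rw [Submodule.dense_iff_topologicalClosure_eq_top, ← hS, eq_top_iff,
    ← (Submodule.dense_iff_topologicalClosure_eq_top.1 (dense_span_range_tprod (H := H)))]
  refine Submodule.topologicalClosure_minimal _ ?_ hc
  rw [Submodule.span_le]
  rintro _ ⟨f, rfl⟩
  exact key Finset.univ f (by simp)

end HilbertTensor

theorem NativeSpace.exists_tensor.{u} {κ : Type} [Fintype κ] {X : κ → Type u}
    (Φ : ∀ j, X j → X j → ℝ) (hΦ : ∀ j, IsReproducingKernel (Φ j)) :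
    ∃ (hT : IsReproducingKernel fun x y : (∀ j, X j) => ∏ j, Φ j (x j) (y j))
      (e : HilbertTensor (fun j => NativeSpace (Φ j) (hΦ j)) ≃ₗᵢ[ℝ] NativeSpace _ hT),
      ∀ (f : ∀ j, NativeSpace (Φ j) (hΦ j)) (x : ∀ j, X j),
        e (HilbertTensor.tprod f) x = ∏ j, f j (x j) := by
  let k : (∀ j, X j) → HilbertTensor (fun j => NativeSpace (Φ j) (hΦ j)) :=
    fun x => HilbertTensor.tprod fun j => ker (Φ j) (hΦ j) (x j)
  have hk : ∀ w, (∀ x, inner ℝ (k x) w = 0) → w = 0 :=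
    dense_span_range_iff.1 (HilbertTensor.dense_span_tprod fun j => dense_span_ker)
  have h (x y : ∀ j, X j) : inner ℝ (k x) (k y) = ∏ j, Φ j (x j) (y j) := by
    simp only [k, HilbertTensor.inner_tprod, inner_ker_ker]
  have hT := isReproducingKernel_of_feature hk h
  obtain ⟨e, he⟩ := exists_linearIsometryEquiv_of_feature (hΦ := hT) hk h
  refine ⟨hT, e, fun f x => ?_⟩
  simp only [he, k, HilbertTensor.inner_tprod, inner_ker]

/-! ### The Fourier transform on `L²` -/

section Fourier

variable {E : Type*} [NormedAddCommGroup E] [InnerProductSpace ℝ E] [FiniteDimensional ℝ E]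
  [MeasurableSpace E] [BorelSpace E]

theorem Real.continuous_fourier_of_integrable {g : E → ℂ} (h : Integrable g) : Continuous (𝓕 g) :=
  VectorFourier.fourierIntegral_continuous Real.continuous_fourierChar
    (by exact continuous_inner) h

theorem Real.continuous_fourierInv_of_integrable {g : E → ℂ} (h : Integrable g) :
    Continuous (𝓕⁻ g) := by
  have : 𝓕⁻ g = fun x => 𝓕 g (-x) := funext fun x => Real.fourierInv_eq_fourier_neg g x
  rw [this]
  exact (Real.continuous_fourier_of_integrable h).comp continuous_neg

theorem ae_eq_of_integral_schwartzMap_smul_eq {u v : E → ℂ} (hu : LocallyIntegrable u)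
    (hv : LocallyIntegrable v) (h : ∀ S : SchwartzMap E ℂ, ∫ x, S x • u x = ∫ x, S x • v x) :
    u =ᵐ[volume] v := by
  refine ae_eq_of_integral_contDiff_smul_eq hu hv fun s hs hc => ?_
  have hs' : ContDiff ℝ ((⊤ : ℕ∞) : WithTop ℕ∞) fun x => (s x : ℂ) :=
    Complex.ofRealCLM.contDiff.comp hs
  have hc' : HasCompactSupport fun x => (s x : ℂ) := hc.comp_left Complex.ofReal_zero
  exact h (hc'.toSchwartzMap hs')

/-- On integrable functions the `L²` Fourier transform is given by the Fourier integral. -/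
theorem MeasureTheory.MemLp.coeFn_fourier_toLp {g : E → ℂ} (h₁ : Integrable g)
    (h₂ : MemLp g 2 volume) : (𝓕 h₂.toLp : Lp ℂ 2 (volume : Measure E)) =ᵐ[volume] 𝓕 g := by
  refine ae_eq_of_integral_schwartzMap_smul_eq ((Lp.memLp _).locallyIntegrable (by norm_num))
    (Real.continuous_fourier_of_integrable h₁).locallyIntegrable fun S => ?_
  have h := congrArg (fun T => T S) (Lp.fourier_toTemperedDistribution_eq h₂.toLp)
  simp only [TemperedDistribution.fourier_apply, Lp.toTemperedDistribution_apply] at h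
  rw [← h]
  trans ∫ x, 𝓕 S x • g x
  · refine integral_congr_ae ?_
    filter_upwards [h₂.coeFn_toLp] with x hx
    rw [hx]
  · have := VectorFourier.integral_fourierIntegral_smul_eq_flip (L := innerₗ E) (μ := volume)
      (ν := volume) Real.continuous_fourierChar (by exact continuous_inner) S.integrable h₁
    rw [flip_innerₗ] at this
    rw [SchwartzMap.fourier_coe]
    exact this

/-- On integrable functions the inverse of the `L²` Fourier transform is given by the inverse
Fourier integral. -/
theorem MeasureTheory.MemLp.coeFn_fourierInv_toLp {g : E → ℂ} (h₁ : Integrable g)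
    (h₂ : MemLp g 2 volume) : (𝓕⁻ h₂.toLp : Lp ℂ 2 (volume : Measure E)) =ᵐ[volume] 𝓕⁻ g := by
  refine ae_eq_of_integral_schwartzMap_smul_eq ((Lp.memLp _).locallyIntegrable (by norm_num))
    (Real.continuous_fourierInv_of_integrable h₁).locallyIntegrable fun S => ?_
  have h := congrArg (fun T => T S) (Lp.fourierInv_toTemperedDistribution_eq h₂.toLp)
  simp only [TemperedDistribution.fourierInv_apply, Lp.toTemperedDistribution_apply] at h
  rw [← h]
  trans ∫ x, 𝓕⁻ S x • g x
  · refine integral_congr_ae ?_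
    filter_upwards [h₂.coeFn_toLp] with x hx
    rw [hx]
  · have := VectorFourier.integral_fourierIntegral_smul_eq_flip (L := -innerₗ E) (μ := volume)
      (ν := volume) Real.continuous_fourierChar (by exact continuous_inner.neg) S.integrable h₁
    have hf : (-innerₗ E).flip = -innerₗ E := by
      ext x y
      simp [real_inner_comm]
    rw [hf] at this
    rw [SchwartzMap.fourierInv_coe]
    exact this

/-- The Fourier transform of the complex conjugate of a function. -/
theorem coeFn_fourier_conj (f : Lp ℂ 2 (volume : Measure E)) :
    (𝓕 (Complex.conjCLE.toContinuousLinearMap.compLp f) : Lp ℂ 2 (volume : Measure E)) =ᵐ[volume]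
      fun ω => starRingEnd ℂ ((𝓕 f : Lp ℂ 2 (volume : Measure E)) (-ω)) := by
  let C : Lp ℂ 2 (volume : Measure E) →L[ℝ] Lp ℂ 2 (volume : Measure E) :=
    Complex.conjCLE.toContinuousLinearMap.compLpL 2 volume
  have hneg := Measure.measurePreserving_neg (volume : Measure E)
  let R := Lp.compMeasurePreservingₗᵢ (p := 2) ℂ (Neg.neg : E → E) hneg (E := ℂ)
  have hC (u : Lp ℂ 2 (volume : Measure E)) : C u =ᵐ[volume] fun x => starRingEnd ℂ (u x) :=
    ContinuousLinearMap.coeFn_compLp _ u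
  have hR (u : Lp ℂ 2 (volume : Measure E)) : R u =ᵐ[volume] fun x => u (-x) :=
    Lp.coeFn_compMeasurePreserving u hneg
  have key : 𝓕 (C f) = C (R (𝓕 f)) := by
    have hcont : Continuous fun u : Lp ℂ 2 (volume : Measure E) =>
      (𝓕 u : Lp ℂ 2 (volume : Measure E)) := (Lp.fourierTransformₗᵢ E ℂ).continuous
    refine DenseRange.induction_on (p := fun u => 𝓕 (C u) = C (R (𝓕 u)))
      (SchwartzMap.denseRange_toLpCLM (p := 2) ENNReal.ofNat_ne_top) f
      (isClosed_eq (hcont.comp C.continuous) (C.continuous.comp (R.continuous.comp hcont)))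
      fun s => ?_
    have i₁ : Integrable fun x => starRingEnd ℂ (s x) :=
      Complex.conjCLE.toContinuousLinearMap.integrable_comp s.integrable
    have i₂ : MemLp (fun x => starRingEnd ℂ (s x)) 2 volume :=
      Complex.conjCLE.toContinuousLinearMap.comp_memLp' (s.memLp 2 volume)
    have e₁ : C (s.toLp 2 volume) = i₂.toLp := by
      refine Lp.ext ?_
      filter_upwards [hC (s.toLp 2 volume), i₂.coeFn_toLp, s.coeFn_toLp 2 volume] with x h1 h2 h3
      rw [h1, h2, h3]
    change 𝓕 (C (s.toLp 2 volume)) = C (R (𝓕 (s.toLp 2 volume)))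
    rw [e₁, SchwartzMap.toLp_fourier_eq]
    refine Lp.ext ?_
    filter_upwards [i₂.coeFn_fourier_toLp i₁, hC (R ((𝓕 s).toLp 2 volume)),
      hR ((𝓕 s).toLp 2 volume),
      hneg.quasiMeasurePreserving.ae ((𝓕 s).coeFn_toLp 2 volume)] with x h1 h2 h3 h4
    rw [h1, h2, h3, h4, SchwartzMap.fourier_coe, Real.fourier_eq', Real.fourier_eq',
      ← integral_conj]
    refine integral_congr_ae (.of_forall fun y => ?_)
    simp only [smul_eq_mul, map_mul, ← Complex.exp_conj, Complex.conj_ofReal, Complex.conj_I,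
      inner_neg_right]
    push_cast
    ring_nf
  change (𝓕 (C f) : Lp ℂ 2 (volume : Measure E)) =ᵐ[volume] _
  rw [key]
  filter_upwards [hC (R (𝓕 f)), hR (𝓕 f)] with x h1 h2
  rw [h1, h2]

end Fourier

section RealFourier

variable {ι : Type*} [Fintype ι]

/-- `g (-ω)` is the complex conjugate of `g ω`; these are the Fourier transforms of the real-valued
functions. -/
def IsHermitianAE (g : EuclideanSpace ℝ ι → ℂ) : Prop :=
  ∀ᵐ ω, g (-ω) = starRingEnd ℂ (g ω)

theorem l2Fourier_eq (f : Lp ℝ 2 (volume : Measure (EuclideanSpace ℝ ι))) :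
    l2Fourier f = 𝓕 (Complex.ofRealCLM.compLp f) := rfl

theorem isHermitianAE_l2Fourier (f : Lp ℝ 2 (volume : Measure (EuclideanSpace ℝ ι))) :
    IsHermitianAE (l2Fourier f) := by
  have h : Complex.conjCLE.toContinuousLinearMap.compLp (Complex.ofRealCLM.compLp f) =
      Complex.ofRealCLM.compLp f := by
    refine Lp.ext ?_
    filter_upwards [Complex.conjCLE.toContinuousLinearMap.coeFn_compLp
      (Complex.ofRealCLM.compLp f), Complex.ofRealCLM.coeFn_compLp f] with x h1 h2
    rw [h1, h2]
    exact Complex.conj_ofReal _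
  have := coeFn_fourier_conj (Complex.ofRealCLM.compLp f)
  rw [h, ← l2Fourier_eq] at this
  filter_upwards [this] with ω hω
  rw [hω, Complex.conj_conj]

theorem exists_l2Fourier_eq (g : Lp ℂ 2 (volume : Measure (EuclideanSpace ℝ ι)))
    (hg : IsHermitianAE g) : ∃ f : Lp ℝ 2 (volume : Measure (EuclideanSpace ℝ ι)),
      l2Fourier f = g := by
  set h := 𝓕⁻ g with hh
  have hF : 𝓕 h = g := fourier_fourierInv_eq g
  have h1 : Complex.conjCLE.toContinuousLinearMap.compLp h = h := by
    refine (Lp.fourierTransformₗᵢ (EuclideanSpace ℝ ι) ℂ).injective ?_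
    change 𝓕 (Complex.conjCLE.toContinuousLinearMap.compLp h) = 𝓕 h
    refine Lp.ext ?_
    rw [hF]
    filter_upwards [coeFn_fourier_conj h, hg] with ω h1 h2
    rw [h1, hF, h2, Complex.conj_conj]
  refine ⟨Complex.reCLM.compLp h, ?_⟩
  have h2 : Complex.ofRealCLM.compLp (Complex.reCLM.compLp h) = h := by
    refine Lp.ext ?_
    have h3 := Complex.conjCLE.toContinuousLinearMap.coeFn_compLp h
    rw [h1] at h3
    filter_upwards [Complex.ofRealCLM.coeFn_compLp (Complex.reCLM.compLp h),
      Complex.reCLM.coeFn_compLp h, h3] with x h4 h5 h6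
    rw [h4, h5]
    exact Complex.conj_eq_iff_re.1 h6.symm
  rw [l2Fourier_eq, h2, hF]

/-- Fourier inversion for real functions in `L²` with integrable Fourier transform. -/
theorem coeFn_eq_fourierInv_l2Fourier (f : Lp ℝ 2 (volume : Measure (EuclideanSpace ℝ ι)))
    (hf : Integrable (l2Fourier f)) :
    ∀ᵐ x, (f x : ℂ) = 𝓕⁻ (l2Fourier f : EuclideanSpace ℝ ι → ℂ) x := by
  have h1 := (Lp.memLp (l2Fourier f)).coeFn_fourierInv_toLp hf
  rw [Lp.toLp_coeFn, l2Fourier_eq, fourierInv_fourier_eq] at h1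
  filter_upwards [h1, Complex.ofRealCLM.coeFn_compLp f] with x h2 h3
  rw [l2Fourier_eq, ← h2, h3]
  rfl

end RealFourier

/-! ### Partitions into blocks -/

section Block

variable {ι κ : Type*}

theorem block_apply (B : Finset ι) (x : EuclideanSpace ℝ ι) (i : B) : block B x i = x i := rfl

theorem block_sub (B : Finset ι) (x y : EuclideanSpace ℝ ι) :
    block B (x - y) = block B x - block B y := rfl

theorem block_neg (B : Finset ι) (x : EuclideanSpace ℝ ι) : block B (-x) = -block B x := rfl

theorem continuous_block (B : Finset ι) : Continuous (block B) :=
  (PiLp.continuous_toLp 2 _).comp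
    (continuous_pi fun i => (continuous_apply (i : ι)).comp (PiLp.continuous_ofLp 2 _))

theorem norm_block_univ [Fintype ι] (x : EuclideanSpace ℝ ι) : ‖block Finset.univ x‖ = ‖x‖ := by
  rw [EuclideanSpace.norm_eq, EuclideanSpace.norm_eq]
  simp only [block_apply]
  rw [Finset.sum_coe_sort Finset.univ fun i => ‖x i‖ ^ 2]

theorem isBlockPartition_univ [Fintype ι] :
    IsBlockPartition (fun _ : Fin 1 => (Finset.univ : Finset ι)) :=
  ⟨fun j k h => (h (Subsingleton.elim j k)).elim, fun i => ⟨0, Finset.mem_univ i⟩⟩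

namespace IsBlockPartition

variable {D : κ → Finset ι} (hD : IsBlockPartition D)

include hD

/-- A product over the index set is the product over the blocks of the products over each block. -/
@[to_additive /-- A sum over the index set is the sum over the blocks of the sums over each
block. -/]
theorem prod_prod_eq [Fintype ι] [Fintype κ] {M : Type*} [CommMonoid M] (f : ι → M) :
    ∏ j, ∏ i : D j, f i = ∏ i, f i := by
  classical
  have h : (Finset.univ : Finset ι) = Finset.univ.biUnion D := by
    ext i
    simpa using hD.2 i
  rw [h, Finset.prod_biUnion fun j _ k _ hjk => hD.1 j k hjk]
  exact Finset.prod_congr rfl fun j _ => Finset.prod_coe_sort (D j) f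

theorem inner_eq_sum [Fintype ι] [Fintype κ] (x y : EuclideanSpace ℝ ι) :
    inner ℝ x y = ∑ j, inner ℝ (block (D j) x) (block (D j) y) := by
  simp only [PiLp.inner_apply, block_apply]
  exact (hD.sum_sum_eq fun i => inner ℝ (x i) (y i)).symm

/-- Families on the blocks can be glued. -/
theorem exists_eq {α : Type*} (y : ∀ j, D j → α) : ∃ x : ι → α, ∀ j (i : D j), x i = y j i := by
  choose b hb using hD.2
  refine ⟨fun i => y (b i) ⟨i, hb i⟩, fun j ⟨i, hi⟩ => ?_⟩
  have hj : b i = j := by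
    by_contra h
    exact Finset.disjoint_left.1 (hD.1 _ _ h) (hb i) hi
  subst hj
  rfl

theorem exists_block_eq (y : ∀ j, EuclideanSpace ℝ (D j)) :
    ∃ x : EuclideanSpace ℝ ι, ∀ j, block (D j) x = y j := by
  obtain ⟨x, hx⟩ := hD.exists_eq fun j => (y j).ofLp
  exact ⟨WithLp.toLp 2 x, fun j => PiLp.ext fun i => hx j i⟩

variable [Fintype ι] [Fintype κ]

theorem measurePreserving_restrict :
    MeasurePreserving (fun (x : ι → ℝ) (j : κ) (i : D j) => x i) volume volume := by
  have hm : Measurable (fun (x : ι → ℝ) (j : κ) (i : D j) => x i) :=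
    measurable_pi_lambda _ fun j => measurable_pi_lambda _ fun i => measurable_pi_apply _
  refine ⟨hm, (Measure.pi_eq_generateFrom
    (C := fun j => Set.pi Set.univ '' Set.pi Set.univ fun _ : D j => {s : Set ℝ | MeasurableSet s})
    (fun j => generateFrom_pi) (fun j => isPiSystem_pi) (fun j =>
      Measure.FiniteSpanningSetsIn.pi fun _ => volume.toFiniteSpanningSetsIn) ?_).symm⟩
  intro s hs
  choose t ht hst using hs
  obtain ⟨r, hr⟩ := hD.exists_eq t
  have hpre : (fun (x : ι → ℝ) (j : κ) (i : D j) => x i) ⁻¹' Set.univ.pi s = Set.univ.pi r := by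
    ext x
    simp only [Set.mem_preimage, Set.mem_univ_pi, ← hst, ← hr]
    refine ⟨fun h i => ?_, fun h j i => h i⟩
    obtain ⟨j, hj⟩ := hD.2 i
    exact h j ⟨i, hj⟩
  have hsm (j : κ) : MeasurableSet (s j) := by
    rw [← hst]
    exact MeasurableSet.univ_pi fun i => ht j i (Set.mem_univ i)
  rw [Measure.map_apply hm (MeasurableSet.univ_pi hsm), hpre, volume_pi_pi,
    ← hD.prod_prod_eq]
  refine Finset.prod_congr rfl fun j _ => ?_
  rw [← hst]
  refine Eq.trans ?_ (volume_pi_pi (t j)).symm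
  exact Finset.prod_congr rfl fun i _ => by rw [hr]

theorem measurePreserving_block :
    MeasurePreserving (fun (x : EuclideanSpace ℝ ι) (j : κ) => block (D j) x) volume volume := by
  have h := (volume_preserving_pi fun j : κ => PiLp.volume_preserving_toLp (D j)).comp
    (hD.measurePreserving_restrict.comp (PiLp.volume_preserving_ofLp ι))
  exact h

theorem quasiMeasurePreserving_block (j : κ) :
    Measure.QuasiMeasurePreserving (block (D j)) volume volume :=
  (Measure.quasiMeasurePreserving_eval _ j).comp hD.measurePreserving_block.quasiMeasurePreserving

theorem integrable_prod_block {𝕜 : Type*} [RCLike 𝕜] {g : ∀ j, EuclideanSpace ℝ (D j) → 𝕜}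
    (hg : ∀ j, Integrable (g j)) : Integrable fun ω => ∏ j, g j (block (D j) ω) :=
  hD.measurePreserving_block.integrable_comp_of_integrable (Integrable.fintype_prod_dep hg)

theorem integral_prod_block {𝕜 : Type*} [RCLike 𝕜] {g : ∀ j, EuclideanSpace ℝ (D j) → 𝕜}
    (hg : ∀ j, Integrable (g j)) :
    ∫ ω, ∏ j, g j (block (D j) ω) = ∏ j, ∫ ω, g j ω := by
  have h := hD.measurePreserving_block
  rw [← integral_fintype_prod_volume_eq_prod, ← h.map_eq, integral_map h.aemeasurable]
  rw [h.map_eq]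
  exact (Integrable.fintype_prod_dep hg).aestronglyMeasurable

/-- The inverse Fourier transform of a tensor product of functions. -/
theorem fourierInv_prod_block {g : ∀ j, EuclideanSpace ℝ (D j) → ℂ} (hg : ∀ j, Integrable (g j))
    (x : EuclideanSpace ℝ ι) :
    𝓕⁻ (fun ω => ∏ j, g j (block (D j) ω)) x = ∏ j, 𝓕⁻ (g j) (block (D j) x) := by
  simp only [Real.fourierInv_eq]
  rw [← hD.integral_prod_block fun j => ?_]
  · refine integral_congr_ae (.of_forall fun ω => ?_)
    simp only [Circle.smul_def, smul_eq_mul, Finset.prod_mul_distrib]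
    congr 1
    rw [hD.inner_eq_sum]
    simp [Real.fourierChar_apply, Finset.mul_sum, Finset.sum_mul, Complex.exp_sum]
  · simpa only [inner_neg_right, neg_neg] using
      (Real.fourierIntegral_convergent_iff (-block (D j) x)).2 (hg j)

/-- The function `∏ j, (1 + |ω_{D j}|²) ^ (-β j)` is integrable. -/
theorem integrable_inv_sobolevWeight_sq {β : κ → ℝ} (hβ : ∀ j, ((D j).card : ℝ) / 2 < β j) :
    Integrable fun ω => (sobolevWeight D β ω ^ 2)⁻¹ := by
  have h := hD.integrable_prod_block (𝕜 := ℝ)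
    (g := fun j ω => (1 + ‖ω‖ ^ 2) ^ (-(2 * β j) / 2)) fun j =>
      integrable_rpow_neg_one_add_norm_sq (by simp; linarith [hβ j])
  refine h.congr (.of_forall fun ω => ?_)
  simp only [sobolevWeight, ← Finset.prod_pow, ← Finset.prod_inv_distrib]
  refine Finset.prod_congr rfl fun j _ => ?_
  rw [← Real.rpow_mul_natCast (by positivity), ← Real.rpow_neg (by positivity)]
  congr 1
  push_cast
  ring

end IsBlockPartition

end Block

/-! ### Hermitian functions -/

section Hermitian

variable {ι : Type*} [Fintype ι] {g h : EuclideanSpace ℝ ι → ℂ}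

theorem ae_comp_neg {p : EuclideanSpace ℝ ι → Prop} (hp : ∀ᵐ ω, p ω) : ∀ᵐ ω, p (-ω) :=
  (Measure.measurePreserving_neg volume).quasiMeasurePreserving.ae hp

theorem IsHermitianAE.congr (hg : IsHermitianAE g) (e : g =ᵐ[volume] h) : IsHermitianAE h := by
  filter_upwards [hg, e, ae_comp_neg e] with ω h1 h2 h3
  rw [← h3, h1, h2]

theorem IsHermitianAE.mul (hg : IsHermitianAE g) (hh : IsHermitianAE h) :
    IsHermitianAE fun ω => g ω * h ω := by
  filter_upwards [hg, hh] with ω h1 h2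
  rw [h1, h2, map_mul]

theorem IsHermitianAE.of_even {q : EuclideanSpace ℝ ι → ℝ} (hq : ∀ᵐ ω, q (-ω) = q ω) :
    IsHermitianAE fun ω => (q ω : ℂ) := by
  filter_upwards [hq] with ω h
  rw [h, Complex.conj_ofReal]

theorem IsHermitianAE.character (x : EuclideanSpace ℝ ι) :
    IsHermitianAE fun ω => ((Real.fourierChar (-inner ℝ ω x) : Circle) : ℂ) := by
  refine .of_forall fun ω => ?_
  simp only
  rw [inner_neg_left, AddChar.map_neg_eq_inv, Circle.coe_inv_eq_conj]

theorem IsHermitianAE.im_fourierInv (hg : IsHermitianAE g) (x : EuclideanSpace ℝ ι) :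
    (𝓕⁻ g x).im = 0 := by
  rw [← Complex.conj_eq_iff_im, Real.fourierInv_eq, ← integral_conj,
    ← integral_neg_eq_self]
  refine integral_congr_ae ?_
  filter_upwards [hg] with ω h
  simp only [Circle.smul_def, smul_eq_mul, map_mul, h, Complex.conj_conj, inner_neg_left,
    AddChar.map_neg_eq_inv, Circle.coe_inv_eq_conj]

end Hermitian

/-! ### The weight -/

section Weight

variable {ι κ : Type*} [Fintype κ] {D : κ → Finset ι} {β : κ → ℝ}

theorem continuous_sobolevWeight : Continuous (sobolevWeight D β) :=
  continuous_finsetProd _ fun j _ =>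
    (continuous_const.add ((continuous_block (D j)).norm.pow 2)).rpow_const
      fun _ => Or.inl (ne_of_gt (add_pos_of_pos_of_nonneg one_pos (sq_nonneg _)))

theorem sobolevWeight_neg (ω : EuclideanSpace ℝ ι) :
    sobolevWeight D β (-ω) = sobolevWeight D β ω := by
  simp only [sobolevWeight, block_neg, norm_neg]

theorem one_le_sobolevWeight (hβ : ∀ j, 0 ≤ β j) (ω : EuclideanSpace ℝ ι) :
    1 ≤ sobolevWeight D β ω := by
  rw [← Finset.prod_const_one (ι := κ) (s := Finset.univ), sobolevWeight]
  refine Finset.prod_le_prod (fun _ _ => zero_le_one) fun j _ =>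
    Real.one_le_rpow ?_ (by linarith [hβ j])
  nlinarith [norm_nonneg (block (D j) ω)]

end Weight

namespace Sobolev

variable {ι κ : Type*} [Fintype ι] [Fintype κ] {D : κ → Finset ι} {β : κ → ℝ}

theorem coeFn_weighted (u : Sobolev D β) : weighted D β u =ᵐ[volume]
    fun ω => sobolevWeight D β ω • l2Fourier (toL2 D β u) ω :=
  (memLp_weighted D β u).coeFn_toLp

theorem coeFn_l2Fourier (u : Sobolev D β) : l2Fourier (toL2 D β u) =ᵐ[volume]
    fun ω => (sobolevWeight D β ω)⁻¹ • weighted D β u ω := by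
  filter_upwards [coeFn_weighted u] with ω h
  rw [h, inv_smul_smul₀ (sobolevWeight_pos D β ω).ne']

theorem isHermitianAE_weighted (u : Sobolev D β) : IsHermitianAE (weighted D β u) := by
  refine ((IsHermitianAE.of_even (.of_forall (sobolevWeight_neg (D := D) (β := β)))).mul
    (isHermitianAE_l2Fourier (toL2 D β u))).congr ?_
  filter_upwards [coeFn_weighted u] with ω h
  rw [h, Complex.real_smul]

theorem inner_eq (u v : Sobolev D β) :
    inner ℝ u v = (∫ ω, starRingEnd ℂ (weighted D β u ω) * weighted D β v ω).re := by
  change (inner ℂ (weighted D β u) (weighted D β v)).re = _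
  rw [L2.inner_def]
  congr 2
  ext ω
  rw [RCLike.inner_apply, mul_comm]

theorem ext_weighted {u v : Sobolev D β} (h : weighted D β u =ᵐ[volume] weighted D β v) : u = v :=
  weighted_injective D β (Lp.ext h)

theorem exists_weighted_eq (hβ : ∀ j, 0 ≤ β j) {g : EuclideanSpace ℝ ι → ℂ}
    (hg : MemLp g 2 volume) (hh : IsHermitianAE g) :
    ∃ u : Sobolev D β, weighted D β u =ᵐ[volume] g := by
  have h2 : MemLp (fun ω => (sobolevWeight D β ω)⁻¹ • g ω) 2 volume := by
    refine hg.mono ((continuous_sobolevWeight.inv₀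
      fun ω => (sobolevWeight_pos D β ω).ne').aestronglyMeasurable.smul hg.1)
      (.of_forall fun ω => ?_)
    rw [norm_smul, norm_inv, Real.norm_of_nonneg (sobolevWeight_pos D β ω).le]
    exact mul_le_of_le_one_left (norm_nonneg _) (inv_le_one_of_one_le₀ (one_le_sobolevWeight hβ ω))
  have h3 : IsHermitianAE h2.toLp := by
    have h4 : IsHermitianAE fun ω => (((sobolevWeight D β ω)⁻¹ : ℝ) : ℂ) * g ω :=
      (IsHermitianAE.of_even (.of_forall fun ω => by rw [sobolevWeight_neg])).mul hh
    refine h4.congr ?_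
    filter_upwards [h2.coeFn_toLp] with ω h
    rw [h, Complex.real_smul]
  obtain ⟨f, hf⟩ := exists_l2Fourier_eq _ h3
  have h5 : (fun ω => sobolevWeight D β ω • l2Fourier f ω) =ᵐ[volume] g := by
    rw [hf]
    filter_upwards [h2.coeFn_toLp] with ω h
    rw [h, smul_inv_smul₀ (sobolevWeight_pos D β ω).ne']
  exact ⟨⟨f, hg.ae_eq h5.symm⟩, (coeFn_weighted _).trans h5⟩

theorem completeSpace (hβ : ∀ j, 0 ≤ β j) : CompleteSpace (Sobolev D β) := by
  have hi : Isometry (weighted D β) :=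
    AddMonoidHomClass.isometry_of_norm (weighted D β) fun u => rfl
  rw [completeSpace_iff_isComplete_range hi.isUniformInducing]
  refine IsClosed.isComplete ?_
  let C : Lp ℂ 2 (volume : Measure (EuclideanSpace ℝ ι)) →L[ℝ] Lp ℂ 2 volume :=
    Complex.conjCLE.toContinuousLinearMap.compLpL 2 volume
  have hneg := Measure.measurePreserving_neg (volume : Measure (EuclideanSpace ℝ ι))
  let R := Lp.compMeasurePreservingₗᵢ (p := 2) ℂ
    (Neg.neg : EuclideanSpace ℝ ι → EuclideanSpace ℝ ι) hneg (E := ℂ)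
  have h : Set.range (weighted D β) = {g | R g = C g} := by
    ext g
    have hC : C g =ᵐ[volume] fun x => starRingEnd ℂ (g x) := ContinuousLinearMap.coeFn_compLp _ g
    have hR : R g =ᵐ[volume] fun x => g (-x) := Lp.coeFn_compMeasurePreserving g hneg
    constructor
    · rintro ⟨u, rfl⟩
      refine Lp.ext ?_
      filter_upwards [hC, hR, isHermitianAE_weighted u] with ω h1 h2 h3
      rw [h1, h2, h3]
    · intro hg
      have hh : IsHermitianAE g := by
        change R g = C g at hg
        rw [hg] at hR
        filter_upwards [hC, hR] with ω h1 h2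
        rw [← h1, h2]
      obtain ⟨u, hu⟩ := exists_weighted_eq (D := D) hβ (Lp.memLp g) hh
      exact ⟨u, Lp.ext hu⟩
  rw [h]
  exact isClosed_eq R.continuous C.continuous

/-! ### Point evaluations -/

variable (D β) in
/-- A positive even function comparable to the reciprocal of the weight. -/
structure IsSymbol (q : EuclideanSpace ℝ ι → ℝ) : Prop where
  aestronglyMeasurable : AEStronglyMeasurable q volume
  even : ∀ᵐ ω, q (-ω) = q ω
  bound : ∃ c C : ℝ, 0 < c ∧ ∀ᵐ ω,
    c * (sobolevWeight D β ω)⁻¹ ≤ q ω ∧ q ω ≤ C * (sobolevWeight D β ω)⁻¹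

theorem isSymbol_inv_sobolevWeight :
    IsSymbol D β fun ω => (sobolevWeight D β ω)⁻¹ where
  aestronglyMeasurable := (continuous_sobolevWeight.inv₀
    fun ω => (sobolevWeight_pos D β ω).ne').aestronglyMeasurable
  even := .of_forall fun ω => by rw [sobolevWeight_neg]
  bound := ⟨1, 1, one_pos, .of_forall fun ω => by simp⟩

section Symbol

variable {q : EuclideanSpace ℝ ι → ℝ} (hq : IsSymbol D β q)

include hq

theorem IsSymbol.pos : ∀ᵐ ω, 0 < q ω := by
  obtain ⟨c, C, hc, h⟩ := hq.bound
  filter_upwards [h] with ω hω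
  exact (mul_pos hc (inv_pos.2 (sobolevWeight_pos D β ω))).trans_le hω.1

theorem IsSymbol.isHermitianAE : IsHermitianAE fun ω => (q ω : ℂ) := .of_even hq.even

variable (hD : IsBlockPartition D) (hβ : ∀ j, ((D j).card : ℝ) / 2 < β j)

include hD hβ

theorem IsSymbol.memLp : MemLp q 2 volume := by
  have h1 : MemLp (fun ω => (sobolevWeight D β ω)⁻¹) 2 volume := by
    refine (memLp_two_iff_integrable_sq ((continuous_sobolevWeight.inv₀
      fun ω => (sobolevWeight_pos D β ω).ne').aestronglyMeasurable)).2 ?_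
    simpa only [Pi.inv_apply, inv_pow] using hD.integrable_inv_sobolevWeight_sq hβ
  obtain ⟨c, C, -, h⟩ := hq.bound
  refine (h1.const_mul C).mono hq.aestronglyMeasurable ?_
  filter_upwards [h, hq.pos] with ω h2 h3
  rw [Real.norm_of_nonneg h3.le]
  exact h2.2.trans (Real.le_norm_self _)

theorem IsSymbol.memLp_mul_character (x : EuclideanSpace ℝ ι) :
    MemLp (fun ω => (q ω : ℂ) * ((Real.fourierChar (-inner ℝ ω x) : Circle) : ℂ)) 2 volume := by
  have h : Continuous fun ω : EuclideanSpace ℝ ι => ((Real.fourierChar (-inner ℝ ω x) : Circle) : ℂ) :=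
    continuous_subtype_val.comp (Real.continuous_fourierChar.comp (by fun_prop))
  have h0 : MemLp (fun ω => (q ω : ℂ)) 2 volume := (hq.memLp hD hβ).ofReal
  refine h0.mono (h0.1.mul h.aestronglyMeasurable) (.of_forall fun ω => ?_)
  rw [norm_mul, Circle.norm_coe, mul_one]

theorem IsSymbol.exists_kernel (x : EuclideanSpace ℝ ι) : ∃ u : Sobolev D β,
    weighted D β u =ᵐ[volume] fun ω => (q ω : ℂ) * ((Real.fourierChar (-inner ℝ ω x) : Circle) : ℂ) :=
  exists_weighted_eq (fun j => (by positivity : (0 : ℝ) ≤ _).trans (hβ j).le)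
    (hq.memLp_mul_character hD hβ x) (hq.isHermitianAE.mul (.character x))

/-- The element of the Sobolev space with `weighted = q * exp (-2πi⟨·, x⟩)`. -/
noncomputable def IsSymbol.kernel (x : EuclideanSpace ℝ ι) : Sobolev D β :=
  (hq.exists_kernel hD hβ x).choose

theorem IsSymbol.coeFn_weighted_kernel (x : EuclideanSpace ℝ ι) :
    weighted D β (hq.kernel hD hβ x) =ᵐ[volume]
      fun ω => (q ω : ℂ) * ((Real.fourierChar (-inner ℝ ω x) : Circle) : ℂ) :=
  (hq.exists_kernel hD hβ x).choose_spec

theorem IsSymbol.inner_kernel (x : EuclideanSpace ℝ ι) (u : Sobolev D β) :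
    inner ℝ (hq.kernel hD hβ x) u = (𝓕⁻ (fun ω => (q ω : ℂ) * weighted D β u ω) x).re := by
  rw [inner_eq, Real.fourierInv_eq]
  congr 1
  refine integral_congr_ae ?_
  filter_upwards [hq.coeFn_weighted_kernel hD hβ x] with ω h
  rw [h, map_mul, Complex.conj_ofReal, AddChar.map_neg_eq_inv, Circle.coe_inv_eq_conj,
    Complex.conj_conj, Circle.smul_def, smul_eq_mul]
  ring

theorem IsSymbol.inner_kernel_kernel (x y : EuclideanSpace ℝ ι) :
    inner ℝ (hq.kernel hD hβ x) (hq.kernel hD hβ y) =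
      (𝓕⁻ (fun ω => ((q ω ^ 2 : ℝ) : ℂ)) (x - y)).re := by
  rw [inner_kernel, Real.fourierInv_eq, Real.fourierInv_eq]
  congr 1
  refine integral_congr_ae ?_
  filter_upwards [hq.coeFn_weighted_kernel hD hβ y] with ω h
  rw [h, inner_sub_right, sub_eq_add_neg, AddChar.map_add_eq_mul, Circle.smul_def, Circle.smul_def,
    Circle.coe_mul, smul_eq_mul, smul_eq_mul]
  push_cast
  ring

theorem IsSymbol.integrable_mul_weighted (u : Sobolev D β) :
    Integrable fun ω => (q ω : ℂ) * weighted D β u ω :=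
  (hq.memLp hD hβ).ofReal.integrable_mul (Lp.memLp (weighted D β u))

theorem IsSymbol.eq_zero_of_inner_kernel (u : Sobolev D β)
    (hu : ∀ x, inner ℝ (hq.kernel hD hβ x) u = 0) : u = 0 := by
  have h1 := hq.integrable_mul_weighted hD hβ u
  have h2 : MemLp (fun ω => (q ω : ℂ) * weighted D β u ω) 2 volume := by
    obtain ⟨c, C, -, h⟩ := hq.bound
    refine ((Lp.memLp (weighted D β u)).const_mul (C : ℂ)).mono h1.1 ?_
    filter_upwards [h, hq.pos] with ω h2 h3
    rw [norm_mul, norm_mul, Complex.norm_real, Real.norm_of_nonneg h3.le, Complex.norm_real]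
    have hw : (sobolevWeight D β ω)⁻¹ ≤ 1 := inv_le_one_of_one_le₀
      (one_le_sobolevWeight (fun j => (by positivity : (0 : ℝ) ≤ _).trans (hβ j).le) ω)
    have hw' := inv_pos.2 (sobolevWeight_pos D β ω)
    gcongr
    refine h2.2.trans ((le_abs_self _).trans ?_)
    rw [abs_mul, abs_of_pos hw']
    exact mul_le_of_le_one_right (abs_nonneg _) hw
  have h3 : 𝓕⁻ (fun ω => (q ω : ℂ) * weighted D β u ω) = 0 := by
    ext x
    refine Complex.ext ?_ ((hq.isHermitianAE.mul (isHermitianAE_weighted u)).im_fourierInv x)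
    rw [← hq.inner_kernel hD hβ, hu]
    rfl
  have h4 := h2.coeFn_fourierInv_toLp h1
  rw [h3] at h4
  have h5 : h2.toLp = 0 := by
    have h6 : (𝓕⁻ h2.toLp : Lp ℂ 2 (volume : Measure (EuclideanSpace ℝ ι))) = 0 :=
      Lp.ext (h4.trans (Lp.coeFn_zero ℂ 2 _).symm)
    exact (Lp.fourierTransformₗᵢ (EuclideanSpace ℝ ι) ℂ).symm.injective (h6.trans (map_zero _).symm)
  refine ext_weighted ?_
  rw [map_zero]
  have h6 := h2.coeFn_toLp
  rw [h5] at h6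
  filter_upwards [h6, Lp.coeFn_zero ℂ 2 (volume : Measure (EuclideanSpace ℝ ι)), hq.pos]
    with ω h7 h8 h9
  rw [h8] at h7 ⊢
  exact ((mul_eq_zero.1 h7.symm).resolve_left (by exact_mod_cast h9.ne'))

end Symbol

section Eval

variable (hD : IsBlockPartition D) (hβ : ∀ j, ((D j).card : ℝ) / 2 < β j)

/-- The element of the Sobolev space that represents the evaluation at `x`. -/
noncomputable def ker (x : EuclideanSpace ℝ ι) : Sobolev D β :=
  isSymbol_inv_sobolevWeight.kernel hD hβ x

theorem inner_ker (x : EuclideanSpace ℝ ι) (u : Sobolev D β) :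
    inner ℝ (ker hD hβ x) u =
      (𝓕⁻ (l2Fourier (toL2 D β u) : EuclideanSpace ℝ ι → ℂ) x).re := by
  rw [ker, IsSymbol.inner_kernel]
  congr 1
  refine Real.fourierInv_congr_ae ?_ x
  filter_upwards [coeFn_l2Fourier u] with ω h
  rw [h, Complex.real_smul]

include hD hβ in
theorem integrable_l2Fourier (u : Sobolev D β) : Integrable (l2Fourier (toL2 D β u)) := by
  refine (isSymbol_inv_sobolevWeight.integrable_mul_weighted hD hβ u).congr ?_
  filter_upwards [coeFn_l2Fourier u] with ω h
  rw [h, Complex.real_smul]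

theorem continuous_inner_ker (u : Sobolev D β) : Continuous fun x => inner ℝ (ker hD hβ x) u := by
  simp only [inner_ker]
  exact Complex.continuous_re.comp
    (Real.continuous_fourierInv_of_integrable (integrable_l2Fourier hD hβ u))

theorem inner_ker_ae_eq (u : Sobolev D β) :
    (fun x => inner ℝ (ker hD hβ x) u) =ᵐ[volume] toL2 D β u := by
  filter_upwards [coeFn_eq_fourierInv_l2Fourier (toL2 D β u) (integrable_l2Fourier hD hβ u)]
    with x h
  rw [inner_ker, ← h, Complex.ofReal_re]

theorem isRestriction_iff {Γ : Set (EuclideanSpace ℝ ι)} {u : Sobolev D β} {f : Γ → ℝ} :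
    IsRestriction D β Γ u f ↔ ∀ x : Γ, inner ℝ (ker hD hβ x) u = f x := by
  constructor
  · rintro ⟨g, hg, hgu, hf⟩ x
    rw [hf x]
    exact congrFun (Continuous.ae_eq_iff_eq volume (continuous_inner_ker hD hβ u) hg
      |>.1 ((inner_ker_ae_eq hD hβ u).trans hgu.symm)) x
  · intro h
    exact ⟨_, continuous_inner_ker hD hβ u, inner_ker_ae_eq hD hβ u, fun x => (h x).symm⟩

end Eval

/-! ### Multiplication of the Fourier transform -/

section Multiplier

theorem exists_multiplier (hβ : ∀ j, 0 ≤ β j) {m : EuclideanSpace ℝ ι → ℝ}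
    (hm : AEStronglyMeasurable m volume) (he : ∀ᵐ ω, m (-ω) = m ω) {C : ℝ}
    (hC : ∀ᵐ ω, |m ω| ≤ C) : ∃ T : Sobolev D β →L[ℝ] Sobolev D β,
      ∀ u, weighted D β (T u) =ᵐ[volume] fun ω => (m ω : ℂ) * weighted D β u ω := by
  have hle (u : Sobolev D β) : ∀ᵐ ω, ‖(m ω : ℂ) * weighted D β u ω‖ ≤ C * ‖weighted D β u ω‖ := by
    filter_upwards [hC] with ω h
    rw [norm_mul, Complex.norm_real]
    exact mul_le_mul_of_nonneg_right h (norm_nonneg _)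
  have hmem (u : Sobolev D β) : MemLp (fun ω => (m ω : ℂ) * weighted D β u ω) 2 volume :=
    (Lp.memLp (weighted D β u)).of_le_mul
      ((Complex.continuous_ofReal.comp_aestronglyMeasurable hm).mul (Lp.aestronglyMeasurable _))
      (hle u)
  choose T hT using fun u : Sobolev D β => exists_weighted_eq (D := D) hβ (hmem u)
    ((IsHermitianAE.of_even he).mul (isHermitianAE_weighted u))
  have hadd (u v : Sobolev D β) : T (u + v) = T u + T v := by
    refine ext_weighted ?_
    rw [map_add]
    have := hT (u + v)
    rw [map_add] at this
    filter_upwards [this, hT u, hT v, Lp.coeFn_add (weighted D β u) (weighted D β v),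
      Lp.coeFn_add (weighted D β (T u)) (weighted D β (T v))] with ω h1 h2 h3 h4 h5
    rw [h1, h4, h5, Pi.add_apply, Pi.add_apply, h2, h3, mul_add]
  have hsmul (c : ℝ) (u : Sobolev D β) : T (c • u) = c • T u := by
    refine ext_weighted ?_
    have := hT (c • u)
    rw [map_smul] at this
    rw [map_smul]
    filter_upwards [this, hT u, Lp.coeFn_smul c (weighted D β u),
      Lp.coeFn_smul c (weighted D β (T u))] with ω h1 h2 h3 h4
    rw [h1, h3, h4, Pi.smul_apply, Pi.smul_apply, h2, mul_smul_comm]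
  have hnorm (u : Sobolev D β) : ‖T u‖ ≤ C * ‖u‖ := by
    rw [norm_def, norm_def]
    refine Lp.norm_le_mul_norm_of_ae_le_mul ?_
    filter_upwards [hT u, hle u] with ω h1 h2
    rwa [h1]
  let L : Sobolev D β →ₗ[ℝ] Sobolev D β := { toFun := T, map_add' := hadd, map_smul' := hsmul }
  exact ⟨L.mkContinuous C hnorm, hT⟩

theorem IsSymbol.exists_equiv {q : EuclideanSpace ℝ ι → ℝ} (hq : IsSymbol D β q)
    (hD : IsBlockPartition D) (hβ : ∀ j, ((D j).card : ℝ) / 2 < β j) :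
    ∃ T : Sobolev D β ≃L[ℝ] Sobolev D β,
      ∀ u x, inner ℝ (ker hD hβ x) (T u) = inner ℝ (hq.kernel hD hβ x) u := by
  have hβ0 (j : κ) : 0 ≤ β j := (by positivity : (0 : ℝ) ≤ _).trans (hβ j).le
  obtain ⟨c, C, hc, hb⟩ := hq.bound
  have hw : AEStronglyMeasurable (sobolevWeight D β) volume :=
    continuous_sobolevWeight.aestronglyMeasurable
  obtain ⟨T, hT⟩ := exists_multiplier (D := D) hβ0 (m := fun ω => sobolevWeight D β ω * q ω) (C := C)
    (hw.mul hq.aestronglyMeasurable)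
    (by filter_upwards [hq.even] with ω h; rw [h, sobolevWeight_neg]) (by
      filter_upwards [hb, hq.pos] with ω h1 h2
      have h3 := sobolevWeight_pos D β ω
      rw [abs_of_pos (by positivity), mul_comm]
      exact (le_mul_inv_iff₀ h3).1 h1.2)
  obtain ⟨S, hS⟩ := exists_multiplier (D := D) hβ0
    (m := fun ω => (sobolevWeight D β ω * q ω)⁻¹) (C := c⁻¹)
    (hw.mul hq.aestronglyMeasurable).aemeasurable.inv.aestronglyMeasurable
    (by filter_upwards [hq.even] with ω h; rw [h, sobolevWeight_neg]) (by
      filter_upwards [hb, hq.pos] with ω h1 h2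
      have h3 := sobolevWeight_pos D β ω
      rw [abs_of_pos (by positivity)]
      refine inv_anti₀ hc ?_
      rw [mul_comm]
      exact (mul_inv_le_iff₀ h3).1 h1.1)
  refine ⟨ContinuousLinearEquiv.equivOfInverse T S (fun u => ext_weighted ?_)
    (fun u => ext_weighted ?_), fun u x => ?_⟩
  · filter_upwards [hT u, hS (T u), hq.pos] with ω h1 h2 h3
    have h4 : ((sobolevWeight D β ω * q ω : ℝ) : ℂ) ≠ 0 := by
      exact_mod_cast (mul_pos (sobolevWeight_pos D β ω) h3).ne'
    rw [h2, h1, Complex.ofReal_inv, inv_mul_cancel_left₀ h4]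
  · filter_upwards [hS u, hT (S u), hq.pos] with ω h1 h2 h3
    have h4 : ((sobolevWeight D β ω * q ω : ℝ) : ℂ) ≠ 0 := by
      exact_mod_cast (mul_pos (sobolevWeight_pos D β ω) h3).ne'
    rw [h2, h1, Complex.ofReal_inv, mul_inv_cancel_left₀ h4]
  · rw [ker, IsSymbol.inner_kernel, IsSymbol.inner_kernel]
    congr 1
    refine Real.fourierInv_congr_ae ?_ x
    change (fun ω => (((sobolevWeight D β ω)⁻¹ : ℝ) : ℂ) * weighted D β (T u) ω) =ᵐ[volume] _
    filter_upwards [hT u] with ω h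
    have h4 : (sobolevWeight D β ω : ℂ) ≠ 0 := by exact_mod_cast (sobolevWeight_pos D β ω).ne'
    rw [h]
    push_cast
    field_simp

end Multiplier

end Sobolev

/-! ### Sobolev spaces on subsets -/

namespace SobolevOn

variable {ι κ : Type*} [Fintype ι] [Fintype κ] {D : κ → Finset ι} {β : κ → ℝ}
  (hD : IsBlockPartition D) (hβ : ∀ j, ((D j).card : ℝ) / 2 < β j)
  (Γ : Set (EuclideanSpace ℝ ι))

/-- The elements of `H^β_D(ℝ^ι)` that represent the evaluations at the points of `Γ`. -/
noncomputable abbrev kerOn (x : Γ) : Sobolev D β := Sobolev.ker hD hβ x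

/-- `H^β_D(Γ)` is isometric to the closed span of the representers of the evaluations on `Γ`. -/
theorem exists_linearIsometryEquiv :
    ∃ e : closedSpan (kerOn hD hβ Γ) ≃ₗᵢ[ℝ] SobolevOn D β Γ,
      ∀ v x, e v x = inner ℝ (kerOn hD hβ Γ x) (v : Sobolev D β) := by
  have hc : CompleteSpace (Sobolev D β) :=
    Sobolev.completeSpace fun j => (by positivity : (0 : ℝ) ≤ _).trans (hβ j).le
  let V := closedSpan (kerOn hD hβ Γ)
  let r : V → SobolevOn D β Γ := fun v =>
    ⟨fun x => inner ℝ (kerOn hD hβ Γ x) (v : Sobolev D β), v,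
      (Sobolev.isRestriction_iff hD hβ).2 fun x => rfl⟩
  have hr (v : V) : IsRestriction D β Γ v (r v) :=
    (Sobolev.isRestriction_iff hD hβ).2 fun x => rfl
  let L : V →ₗ[ℝ] SobolevOn D β Γ :=
    { toFun := r
      map_add' := fun u v => Subtype.ext <| funext fun x =>
        inner_add_right (kerOn hD hβ Γ x) (u : Sobolev D β) v
      map_smul' := fun c u => Subtype.ext <| funext fun x =>
        real_inner_smul_right (kerOn hD hβ Γ x) (u : Sobolev D β) c }
  have hn (v : V) : ‖L v‖ = ‖v‖ := by
    refine le_antisymm (SobolevOn.norm_le (hr v)) (le_of_forall_pos_le_add fun ε hε => ?_)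
    obtain ⟨u, hu, hlt⟩ := exists_norm_lt (r v) hε
    refine (closedSpan.norm_le (v := v) (w := u) fun x => ?_).trans hlt.le
    exact ((Sobolev.isRestriction_iff hD hβ).1 hu x).symm
  let I : V →ₗᵢ[ℝ] SobolevOn D β Γ := ⟨L, hn⟩
  refine ⟨LinearIsometryEquiv.ofSurjective I fun f => ?_, fun v x => rfl⟩
  obtain ⟨u, hu⟩ := f.2
  obtain ⟨v, hv, -⟩ := closedSpan.exists_inner_eq (k := kerOn hD hβ Γ) u
  refine ⟨v, Subtype.ext <| funext fun x => ?_⟩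
  exact (hv x).trans ((Sobolev.isRestriction_iff hD hβ).1 hu x)

include hD hβ in
theorem completeSpace : CompleteSpace (SobolevOn D β Γ) := by
  have hc : CompleteSpace (Sobolev D β) :=
    Sobolev.completeSpace fun j => (by positivity : (0 : ℝ) ≤ _).trans (hβ j).le
  obtain ⟨e, -⟩ := exists_linearIsometryEquiv hD hβ Γ
  exact (completeSpace_congr (e := e.toEquiv) e.isometry.isUniformEmbedding).1 inferInstance

include hD hβ in
theorem eq_zero_of_norm_eq_zero {f : SobolevOn D β Γ} (hf : ‖f‖ = 0) : f = 0 := by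
  obtain ⟨e, -⟩ := exists_linearIsometryEquiv hD hβ Γ
  rw [← e.symm.norm_map, norm_eq_zero] at hf
  exact (map_eq_zero_iff e.symm e.symm.injective).1 hf

/-- `H^β_D(Γ)` contains representers of the evaluations, and they form a total family. -/
theorem exists_ker : ∃ k : Γ → SobolevOn D β Γ,
    (∀ x f, inner ℝ (k x) f = f x) ∧
    (∀ x y, inner ℝ (k x) (k y) = inner ℝ (kerOn hD hβ Γ x) (kerOn hD hβ Γ y)) ∧
    Dense (Submodule.span ℝ (Set.range k) : Set (SobolevOn D β Γ)) := by
  have hc : CompleteSpace (Sobolev D β) :=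
    Sobolev.completeSpace fun j => (by positivity : (0 : ℝ) ≤ _).trans (hβ j).le
  obtain ⟨e, he⟩ := exists_linearIsometryEquiv hD hβ Γ
  refine ⟨fun x => e (closedSpan.mk _ x), fun x f => ?_, fun x y => e.inner_map_map _ _, ?_⟩
  · rw [← e.apply_symm_apply f, e.inner_map_map, he]
    rfl
  · have h := (e.surjective.denseRange).dense_image e.continuous
      (closedSpan.dense_span_mk (k := kerOn hD hβ Γ))
    have h2 : (Submodule.span ℝ (Set.range fun x => e (closedSpan.mk (kerOn hD hβ Γ) x)) :
        Set (SobolevOn D β Γ)) =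
        e '' (Submodule.span ℝ (Set.range (closedSpan.mk (kerOn hD hβ Γ)))) := by
      have : (Set.range fun x => e (closedSpan.mk (kerOn hD hβ Γ) x)) =
          e.toLinearEquiv.toLinearMap '' Set.range (closedSpan.mk (kerOn hD hβ Γ)) := by
        rw [← Set.range_comp]
        rfl
      rw [this, ← Submodule.map_span]
      rfl
    rwa [h2]

end SobolevOn

/-! ### Product structure of the kernels -/

section Product

variable {ι κ : Type*} [Fintype ι] [Fintype κ] {D : κ → Finset ι} {β : κ → ℝ}
  (hD : IsBlockPartition D)

include hD in
theorem IsBlockPartition.re_fourierInv_prod_block {p : ∀ j, EuclideanSpace ℝ (D j) → ℝ}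
    (hp : ∀ j, Integrable (p j)) (he : ∀ j, ∀ᵐ ω, p j (-ω) = p j ω) (x : EuclideanSpace ℝ ι) :
    (𝓕⁻ (fun ω => ((∏ j, p j (block (D j) ω) : ℝ) : ℂ)) x).re =
      ∏ j, (𝓕⁻ (fun ω => (p j ω : ℂ)) (block (D j) x)).re := by
  push_cast
  rw [hD.fourierInv_prod_block (g := fun j ω => (p j ω : ℂ)) fun j => (hp j).ofReal]
  have h (j : κ) : 𝓕⁻ (fun ω => (p j ω : ℂ)) (block (D j) x) =
      ((𝓕⁻ (fun ω => (p j ω : ℂ)) (block (D j) x)).re : ℂ) :=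
    Complex.ext rfl ((IsHermitianAE.of_even (he j)).im_fourierInv _)
  rw [Finset.prod_congr rfl fun j _ => h j, ← Complex.ofReal_prod, Complex.ofReal_re]

omit [Fintype ι] [Fintype κ] in
theorem card_univ_div_two_lt (hβ : ∀ j, ((D j).card : ℝ) / 2 < β j) (j : κ) :
    ∀ _ : Fin 1, ((Finset.univ : Finset (D j)).card : ℝ) / 2 < β j := fun _ => by
  simpa using hβ j

omit [Fintype ι] in
theorem sobolevWeight_eq_prod (ω : EuclideanSpace ℝ ι) :
    sobolevWeight D β ω = ∏ j, sobolevWeight (fun _ : Fin 1 => (Finset.univ : Finset (D j)))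
      (fun _ => β j) (block (D j) ω) := by
  simp only [sobolevWeight, Finset.univ_unique, Finset.prod_singleton, norm_block_univ]

/-- The kernel of `H^β_D(ℝ^ι)` is the product of the kernels of the spaces on the blocks. -/
theorem Sobolev.inner_ker_ker_eq_prod (hβ : ∀ j, ((D j).card : ℝ) / 2 < β j)
    (x y : EuclideanSpace ℝ ι) :
    inner ℝ (ker hD hβ x) (ker hD hβ y) =
      ∏ j, inner ℝ (ker isBlockPartition_univ (card_univ_div_two_lt hβ j) (block (D j) x))
        (ker isBlockPartition_univ (card_univ_div_two_lt hβ j) (block (D j) y)) := by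
  simp only [ker, IsSymbol.inner_kernel_kernel, ← block_sub]
  rw [← hD.re_fourierInv_prod_block
    (p := fun j ω => ((sobolevWeight (fun _ : Fin 1 => (Finset.univ : Finset (D j)))
      (fun _ => β j) ω)⁻¹) ^ 2)
    (fun j => by
      simpa only [inv_pow] using isBlockPartition_univ.integrable_inv_sobolevWeight_sq
        (card_univ_div_two_lt hβ j))
    fun j => .of_forall fun ω => by rw [sobolevWeight_neg]]
  simp only [sobolevWeight_eq_prod (D := D), ← Finset.prod_inv_distrib, Finset.prod_pow]

end Product

/-! ### Sobolev spaces on product sets -/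

section ProductSet

variable {ι κ : Type*} [Fintype ι] [Fintype κ] {D : κ → Finset ι} {β : κ → ℝ}

theorem SobolevOn.exists_tensor (hD : IsBlockPartition D)
    (hβ : ∀ j, ((D j).card : ℝ) / 2 < β j) (Γ : ∀ j, Set (EuclideanSpace ℝ (D j))) :
    ∃ e : HilbertTensor (fun j => IsotropicSobolevOn (β j) (Γ j)) ≃ₗᵢ[ℝ]
        SobolevOn D β (blockProd D Γ),
      ∀ (f : ∀ j, IsotropicSobolevOn (β j) (Γ j)) (x : blockProd D Γ),
        e (HilbertTensor.tprod f) x = ∏ j, f j ⟨block (D j) x, x.2 j⟩ := by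
  have hc : CompleteSpace (Sobolev D β) :=
    Sobolev.completeSpace fun j => (by positivity : (0 : ℝ) ≤ _).trans (hβ j).le
  choose k hk hkk hkd using fun j => SobolevOn.exists_ker isBlockPartition_univ
    (card_univ_div_two_lt hβ j) (Γ j)
  let k₁ : blockProd D Γ → HilbertTensor (fun j => IsotropicSobolevOn (β j) (Γ j)) :=
    fun x => HilbertTensor.tprod fun j => k j ⟨block (D j) x, x.2 j⟩
  have hd : Dense (Submodule.span ℝ (Set.range k₁) :
      Set (HilbertTensor (fun j => IsotropicSobolevOn (β j) (Γ j)))) := by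
    have h : Set.range k₁ = Set.range fun y : ∀ j, Γ j => HilbertTensor.tprod fun j => k j (y j) := by
      refine Set.Subset.antisymm ?_ ?_
      · rintro _ ⟨x, rfl⟩
        exact ⟨fun j => ⟨block (D j) x, x.2 j⟩, rfl⟩
      · rintro _ ⟨y, rfl⟩
        obtain ⟨x, hx⟩ := hD.exists_block_eq fun j => (y j : EuclideanSpace ℝ (D j))
        have hxΓ (j : κ) : block (D j) x ∈ Γ j := by
          rw [hx]
          exact (y j).2
        refine ⟨⟨x, hxΓ⟩, congrArg HilbertTensor.tprod (funext fun j => congrArg (k j) ?_)⟩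
        exact Subtype.ext (hx j)
    rw [h]
    exact HilbertTensor.dense_span_tprod hkd
  obtain ⟨e₁, he₁⟩ := exists_linearIsometryEquiv_of_inner_eq (k₁ := k₁)
    (k₂ := closedSpan.mk (SobolevOn.kerOn hD hβ (blockProd D Γ)))
    (fun x y => by
      simp only [k₁, HilbertTensor.inner_tprod, hkk]
      exact (Sobolev.inner_ker_ker_eq_prod hD hβ _ _).symm) hd closedSpan.dense_span_mk
  obtain ⟨e₂, he₂⟩ := SobolevOn.exists_linearIsometryEquiv hD hβ (blockProd D Γ)
  refine ⟨e₁.trans e₂, fun f x => ?_⟩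
  rw [LinearIsometryEquiv.trans_apply, he₂]
  change inner ℝ (closedSpan.mk (SobolevOn.kerOn hD hβ (blockProd D Γ)) x)
    (e₁ (HilbertTensor.tprod f)) = _
  rw [← he₁, e₁.inner_map_map]
  simp only [k₁, HilbertTensor.inner_tprod, hk]

end ProductSet

/-! ### Product kernels of Sobolev type -/

section ProductKernel

variable {ι κ : Type*} [Fintype ι] [Fintype κ] {D : κ → Finset ι} {β : κ → ℝ}

theorem NativeSpace.exists_equiv_sobolev (hD : IsBlockPartition D)
    (hβ : ∀ j, ((D j).card : ℝ) / 2 < β j) (φ : ∀ j, EuclideanSpace ℝ (D j) → ℝ)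
    (hφ : ∀ j, MemLp (φ j) 2 volume) (hcont : ∀ j, Continuous (φ j))
    (hb : ∀ j, ∃ c C : ℝ, 0 < c ∧ ∀ᵐ ω : EuclideanSpace ℝ (D j),
      (l2Fourier (hφ j).toLp ω).im = 0 ∧
      c * (1 + ‖ω‖ ^ 2) ^ (-β j) ≤ (l2Fourier (hφ j).toLp ω).re ∧
      (l2Fourier (hφ j).toLp ω).re ≤ C * (1 + ‖ω‖ ^ 2) ^ (-β j)) :
    ∃ (hΦ : IsReproducingKernel fun x y : EuclideanSpace ℝ ι =>
        ∏ j, φ j (block (D j) x - block (D j) y))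
      (e : NativeSpace _ hΦ ≃L[ℝ] Sobolev D β),
      ∀ f : NativeSpace _ hΦ, Continuous (fun x => f x) ∧
        (Sobolev.toL2 D β (e f) : EuclideanSpace ℝ ι → ℝ) =ᵐ[volume] fun x => f x := by
  have hc : CompleteSpace (Sobolev D β) :=
    Sobolev.completeSpace fun j => (by positivity : (0 : ℝ) ≤ _).trans (hβ j).le
  choose c C hcpos hb using hb
  let p (j : κ) (ω : EuclideanSpace ℝ (D j)) : ℝ := (l2Fourier (hφ j).toLp ω).re
  have hpm (j : κ) : AEStronglyMeasurable (p j) volume :=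
    Complex.continuous_re.comp_aestronglyMeasurable (Lp.aestronglyMeasurable _)
  have hpeq (j : κ) : (l2Fourier (hφ j).toLp : EuclideanSpace ℝ (D j) → ℂ) =ᵐ[volume]
      fun ω => (p j ω : ℂ) := by
    filter_upwards [hb j] with ω h
    exact Complex.ext rfl h.1
  have hpe (j : κ) : ∀ᵐ ω, p j (-ω) = p j ω := by
    filter_upwards [isHermitianAE_l2Fourier (hφ j).toLp] with ω h
    simp only [p, h, Complex.conj_re]
  have hpp (j : κ) : ∀ᵐ ω, 0 < p j ω := by
    filter_upwards [hb j] with ω h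
    exact (mul_pos (hcpos j) (by positivity)).trans_le h.2.1
  have hpi (j : κ) : Integrable (p j) := by
    have h : Integrable fun ω : EuclideanSpace ℝ (D j) => (1 + ‖ω‖ ^ 2) ^ (-(2 * β j) / 2) :=
      integrable_rpow_neg_one_add_norm_sq (by simp; linarith [hβ j])
    refine (h.const_mul (C j)).mono' (hpm j) ?_
    filter_upwards [hb j, hpp j] with ω h1 h2
    rw [Real.norm_of_nonneg h2.le]
    refine h1.2.2.trans_eq ?_
    congr 2
    ring
  have hφp (j : κ) (x : EuclideanSpace ℝ (D j)) : (𝓕⁻ (fun ω => (p j ω : ℂ)) x).re = φ j x := by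
    have hcp : Continuous fun x => (𝓕⁻ (fun ω => (p j ω : ℂ)) x).re :=
      Complex.continuous_re.comp (Real.continuous_fourierInv_of_integrable (hpi j).ofReal)
    refine congrFun ((Continuous.ae_eq_iff_eq volume hcp (hcont j)).1 ?_) x
    filter_upwards [coeFn_eq_fourierInv_l2Fourier (hφ j).toLp ((hpi j).ofReal.congr (hpeq j).symm),
      (hφ j).coeFn_toLp] with x h1 h2
    rw [← h2, ← Real.fourierInv_congr_ae (hpeq j), ← h1, Complex.ofReal_re]
  let q (ω : EuclideanSpace ℝ ι) : ℝ := ∏ j, √(p j (block (D j) ω))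
  have hrpow {a t : ℝ} (ht : 0 < t) (b : ℝ) : √(a * t ^ (-b)) = √a * (t ^ (b / 2))⁻¹ := by
    rw [Real.sqrt_mul' _ (by positivity), Real.sqrt_eq_rpow (t ^ (-b)), ← Real.rpow_mul ht.le,
      ← Real.rpow_neg ht.le]
    congr 2
    ring
  have hq : Sobolev.IsSymbol D β q := by
    refine ⟨?_, ?_, ∏ j, √(c j), ∏ j, √(C j), Finset.prod_pos fun j _ => Real.sqrt_pos.2 (hcpos j),
      ?_⟩
    · refine Finset.aestronglyMeasurable_fun_prod _ fun j _ => ?_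
      exact Real.continuous_sqrt.comp_aestronglyMeasurable
        ((hpm j).comp_quasiMeasurePreserving (hD.quasiMeasurePreserving_block j))
    · have h := ae_all_iff.2 fun j => (hD.quasiMeasurePreserving_block j).ae (hpe j)
      filter_upwards [h] with ω h
      simp only [q, block_neg, h]
    · have h := ae_all_iff.2 fun j => (hD.quasiMeasurePreserving_block j).ae (hb j)
      filter_upwards [h] with ω h
      simp only [q, sobolevWeight, ← Finset.prod_inv_distrib, ← Finset.prod_mul_distrib]
      refine ⟨Finset.prod_le_prod (fun j _ => by positivity) fun j _ => ?_,
        Finset.prod_le_prod (fun j _ => by positivity) fun j _ => ?_⟩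
      · rw [← hrpow (by positivity)]
        exact Real.sqrt_le_sqrt (h j).2.1
      · rw [← hrpow (by positivity)]
        exact Real.sqrt_le_sqrt (h j).2.2
  have hq2 : (fun ω => ((q ω ^ 2 : ℝ) : ℂ)) =ᵐ[volume]
      fun ω => ((∏ j, p j (block (D j) ω) : ℝ) : ℂ) := by
    have h := ae_all_iff.2 fun j => (hD.quasiMeasurePreserving_block j).ae (hpp j)
    filter_upwards [h] with ω h
    simp only [q, ← Finset.prod_pow]
    rw [Finset.prod_congr rfl fun j _ => Real.sq_sqrt (h j).le]
  have hk (x y : EuclideanSpace ℝ ι) : inner ℝ (hq.kernel hD hβ x) (hq.kernel hD hβ y) =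
      ∏ j, φ j (block (D j) x - block (D j) y) := by
    rw [hq.inner_kernel_kernel, Real.fourierInv_congr_ae hq2, hD.re_fourierInv_prod_block hpi hpe]
    simp only [hφp, block_sub]
  have htot := hq.eq_zero_of_inner_kernel hD hβ
  have hΦ := isReproducingKernel_of_feature htot hk
  obtain ⟨e, he⟩ := exists_linearIsometryEquiv_of_feature (hΦ := hΦ) htot hk
  obtain ⟨T, hT⟩ := hq.exists_equiv hD hβ
  refine ⟨hΦ, e.symm.toContinuousLinearEquiv.trans T, fun f => ?_⟩
  have h (x : EuclideanSpace ℝ ι) : inner ℝ (Sobolev.ker hD hβ x) (T (e.symm f)) = f x := by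
    rw [hT, ← he, e.apply_symm_apply]
  have h1 := Sobolev.continuous_inner_ker hD hβ (T (e.symm f))
  have h2 := Sobolev.inner_ker_ae_eq hD hβ (T (e.symm f))
  simp only [h] at h1 h2
  exact ⟨h1, h2.symm⟩

end ProductKernel

theorem mainTheorem3 :
    -- (i) product kernels and Sobolev spaces
    (∀ (d n : ℕ) (D : Fin n → Finset (Fin d)) (β : Fin n → ℝ),
      IsBlockPartition D → (∀ j, ((D j).card : ℝ) / 2 < β j) →
      ∀ (φ : ∀ j, EuclideanSpace ℝ (D j) → ℝ) (hφ : ∀ j, MemLp (φ j) 2 volume),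
        (∀ j, Continuous (φ j)) →
        (∀ j, ∃ c C : ℝ, 0 < c ∧ ∀ᵐ ω : EuclideanSpace ℝ (D j),
          (l2Fourier (hφ j).toLp ω).im = 0 ∧
          c * (1 + ‖ω‖ ^ 2) ^ (-β j) ≤ (l2Fourier (hφ j).toLp ω).re ∧
          (l2Fourier (hφ j).toLp ω).re ≤ C * (1 + ‖ω‖ ^ 2) ^ (-β j)) →
        ∃ (hΦ : IsReproducingKernel fun x y : EuclideanSpace ℝ (Fin d) =>
            ∏ j, φ j (block (D j) x - block (D j) y))
          (e : NativeSpace _ hΦ ≃L[ℝ] Sobolev D β),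
          ∀ f : NativeSpace _ hΦ, Continuous (fun x => f x) ∧
            (Sobolev.toL2 D β (e f) : EuclideanSpace ℝ (Fin d) → ℝ) =ᵐ[volume] fun x => f x) ∧
    -- (ii) restriction of kernels
    (∀ (X : Type*) (Φ : X → X → ℝ) (hΦ : IsReproducingKernel Φ) (Γ : Set X),
      ∃ hΓ : IsReproducingKernel fun x y : Γ => Φ x y,
        (∀ f : Γ → ℝ, (∃ h : NativeSpace _ hΓ, ∀ x, h x = f x) ↔
          ∃ g : NativeSpace Φ hΦ, ∀ x : Γ, g x = f x) ∧
        ∀ h : NativeSpace _ hΓ,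
          IsGLB {r : ℝ | ∃ g : NativeSpace Φ hΦ, (∀ x : Γ, g x = h x) ∧ r = ‖g‖} ‖h‖) ∧
    -- (iii) tensor products of kernels
    (∀ (n : ℕ) (X : Fin n → Type*) (Φ : ∀ j, X j → X j → ℝ)
      (hΦ : ∀ j, IsReproducingKernel (Φ j)),
      ∃ (hT : IsReproducingKernel fun x y : (∀ j, X j) => ∏ j, Φ j (x j) (y j))
        (e : HilbertTensor (fun j => NativeSpace (Φ j) (hΦ j)) ≃ₗᵢ[ℝ] NativeSpace _ hT),
        ∀ (f : ∀ j, NativeSpace (Φ j) (hΦ j)) (x : ∀ j, X j),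
          e (HilbertTensor.tprod f) x = ∏ j, f j (x j)) ∧
    -- (iv) Sobolev spaces on product sets
    (∀ (d n : ℕ) (D : Fin n → Finset (Fin d)) (β : Fin n → ℝ),
      IsBlockPartition D → (∀ j, ((D j).card : ℝ) / 2 < β j) →
      ∀ Γ : ∀ j, Set (EuclideanSpace ℝ (D j)),
        (∀ j, CompleteSpace (IsotropicSobolevOn (β j) (Γ j)) ∧
          ∀ f : IsotropicSobolevOn (β j) (Γ j), ‖f‖ = 0 → f = 0) ∧
        ∃ e : HilbertTensor (fun j => IsotropicSobolevOn (β j) (Γ j)) ≃ₗᵢ[ℝ]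
            SobolevOn D β (blockProd D Γ),
          ∀ (f : ∀ j, IsotropicSobolevOn (β j) (Γ j)) (x : blockProd D Γ),
            e (HilbertTensor.tprod f) x = ∏ j, f j ⟨block (D j) x, x.2 j⟩) := by
  exact ⟨fun _ _ _ _ hD hβ φ hφ => NativeSpace.exists_equiv_sobolev hD hβ φ hφ,
    fun _ => NativeSpace.exists_restrict, fun _ _ => NativeSpace.exists_tensor,
    fun _ _ _ _ hD hβ Γ => ⟨fun j =>
      ⟨SobolevOn.completeSpace isBlockPartition_univ (card_univ_div_two_lt hβ j) (Γ j),
        fun _ => SobolevOn.eq_zero_of_norm_eq_zero isBlockPartition_univ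
          (card_univ_div_two_lt hβ j) (Γ j)⟩,
      SobolevOn.exists_tensor hD hβ Γ⟩⟩
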